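/- Notation. Configurations are $x=(x_1,\dots,x_n)\in\{1,\dots,d\}^n$ with $n\ge 1$. A matrix product state (MPS) $\theta$ with bond dimensions $r_1,\dots,r_{n-1}$ (and $r_0=r_n=1$) is a collection of real cores $G_k\in\mathbb R^{r_{k-1}\times d\times r_k}$, and $q_\theta(x)=\sum_{\alpha_1,\dots,\alpha_{n-1}}G_1(x_1,\alpha_1)G_2(\alpha_1,x_2,\alpha_2)\cdots G_n(\alpha_{n-1},x_n)$. A probability distribution $p^\star$ is representable by the Born machine $\theta$ if $p^\star(x)=|q_\theta(x)|^2/\sum_z|q_\theta(z)|^2$. Let $R_k$ be the rank of the $k$-th unfolding matrix $p^\star(x_1\cdots x_k;\,x_{k+1}\cdots x_n)$ (with $R_0=R_n=1$). TTNS-Sketch on a path. Let $S_k(\beta,x_1,\dots,x_k)$, $\beta\le m_k$, and $T_k(x_{k+1},\dots,x_n,\gamma)$, $\gamma\le l_k$, be real sketch functions with $m_0=l_n=1$, $S_0=T_n=1$. For a function $p$ on configurations put $W_k(\beta,\gamma)=\sum_x S_k(\beta,x_{\le k})\,p(x)\,T_k(x_{>k},\gamma)$ for $0\le k\le n$ and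 $Z_k(\beta,a;\gamma)=\sum_{x:\,x_k=a}S_{k-1}(\beta,x_{<k})\,p(x)\,T_k(x_{>k},\gamma)$ for $1\le k\le n$. For $1\le k<n$ take a singular value decomposition $Z_k\approx U\Sigma V^{T}$ truncated to the $R_k$ largest singular values and set $q_k=V\Sigma^{-1}$ (reciprocals of zero singular values being read as $0$); set $q_n=1$. Put $B_k=Z_kq_k$ for $1\le k\le n$, $A_0=1$, and $A_k=W_kq_k$ for $1\le k<n$. The output consists of cores $\hat G_k$ that solve $A_{k-1}\hat G_k=B_k$ in the least squares sense, for $k=1,\dots,n$. They form an MPS with bond dimensions $R_k$; write $\hat q$ for its value, $\hat W=\sum_z\hat q(z)$, and $\hat p_{\mathrm{TS}}=\hat q/\hat W$. The sketches preserve the ranks of $p^\star$ with constant $c>0$ if, for every $1\le k<n$, the $R_k$-th largest singular value of $W_k$ formed from $p=p^\star$ is at least $c$. Statement. 1. Let $p^\star$ be representable by a Born machine with bond dimensions $r_1,\dots,r_{n-1}$. Then $R_k\le r_k^2$ for all $k$, and there are sketch functions with values in $[-1,1]$ and with $m_k,l_k\le r_k^2$ for all $k$ that preserve the ranks of $p^\star$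 with some constant $c>0$. 2. For all $d,\ell\in\mathbb N$, $M\in\mathbb R$ and $c>0$ there is a constant $C=C(d,\ell,M,c)>0$ such that the following holds for all $n\ge1$, all distributions $p^\star$ on $\{1,\dots,d\}^n$ representable by a Born machine with bond dimensions $r_k$, all sketch functions bounded in absolute value by $M$, with $m_k,l_k\le\ell$, that preserve the ranks of $p^\star$ with constant $c$, and all $0<\epsilon\le1$, $0<\delta<1$. Run TTNS-Sketch with target ranks $R_k$ on the empirical distribution of $B$ independent samples of $p^\star$, where $$B\ \ge\ C\,\frac{n^2+\epsilon n}{\epsilon^2}\,\log\frac{2n}{\delta}.$$ Then an output exists for every sample, and with probability at least $1-\delta$ every output (whatever choices are made in the singular value decompositions and least squares problems) has bond dimensions at most $r_k^2$, satisfies $\hat W\ne0$, $\|p^\star-\hat p_{\mathrm{TS}}\|_\infty<\epsilon$ and also $\|p^\star-\hat q\|_\infty<\epsilon$. -/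

import Mathlib

open scoped Matrix
open MeasureTheory

noncomputable section

/-- Configurations of `n` variables, each with `d` possible values. -/
abbrev Config (n d : ℕ) : Type := Fin n → Fin d

/-- A matrix product state with open boundary: bond dimensions `bond 0 = 1, …, bond n = 1` and, for
every site `k`, a core `G_k(α, x_k, α')`, where `α` and `α'` are the indices of the bonds to the left
and to the right of the site. -/
structure MPS (n d : ℕ) where
  bond : Fin (n + 1) → ℕ
  bond_zero : bond 0 = 1
  bond_last : bond (Fin.last n) = 1
  core : (k : Fin n) → Fin d → Matrix (Fin (bond k.castSucc)) (Fin (bond k.succ)) ℝ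

namespace MPS

variable {n d : ℕ} (θ : MPS n d)

/-- `q_θ(x) = ∑_α ∏_k G_k(α_{k-1}, x_k, α_k)`. -/
def eval (x : Config n d) : ℝ :=
  ∑ α : (k : Fin (n + 1)) → Fin (θ.bond k), ∏ k : Fin n, θ.core k (x k) (α k.castSucc) (α k.succ)

/-- The Born machine density `|q_θ|² / Z_θ` with `Z_θ = ∑_z |q_θ(z)|²`. -/
def bornDensity (x : Config n d) : ℝ := |θ.eval x| ^ 2 / ∑ z, |θ.eval z| ^ 2

/-- The normalization constant `W_θ = ∑_z q_θ(z)` of the direct MPS ansatz. -/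
def weight : ℝ := ∑ z, θ.eval z

/-- The direct MPS ansatz `q_θ / W_θ`. -/
def directDensity (x : Config n d) : ℝ := θ.eval x / θ.weight

end MPS

/-- The unfolding of a tensor at bond `k`: rows are indexed by the variables to the left of the bond,
columns by the variables to the right of it. -/
def unfolding {n d : ℕ} (p : Config n d → ℝ) (k : Fin (n + 1)) :
    Matrix ({i : Fin n // i.castSucc < k} → Fin d) ({i : Fin n // ¬ i.castSucc < k} → Fin d) ℝ :=
  Matrix.of fun y z => p fun i => if h : i.castSucc < k then y ⟨i, h⟩ else z ⟨i, h⟩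

/-- The rank of the unfolding at bond `k`. -/
def unfoldingRank {n d : ℕ} (p : Config n d → ℝ) (k : Fin (n + 1)) : ℕ := (unfolding p k).rank

/-- Sketch functions for the path `1 - 2 - ⋯ - n`. At every bond `k` there are `m k` left sketch
functions of the variables to the left of the bond and `l k` right sketch functions of the variables
to the right of it. At the two ends the (empty) sketch is the constant `1`. -/
structure Sketch (n d : ℕ) where
  m : Fin (n + 1) → ℕ
  l : Fin (n + 1) → ℕ
  S : (k : Fin (n + 1)) → Config n d → Fin (m k) → ℝ
  T : (k : Fin (n + 1)) → Config n d → Fin (l k) → ℝ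
  S_dependsOn : ∀ k, DependsOn (S k) {i : Fin n | i.castSucc < k}
  T_dependsOn : ∀ k, DependsOn (T k) {i : Fin n | ¬ i.castSucc < k}
  m_zero : m 0 = 1
  l_last : l (Fin.last n) = 1
  S_zero : ∀ x β, S 0 x β = 1
  T_last : ∀ x γ, T (Fin.last n) x γ = 1

namespace Sketch

variable {n d : ℕ} (sk : Sketch n d) (p : Config n d → ℝ)

/-- The sketched tensor at bond `k`: `∑_x S_k(β, x_{≤ k}) p(x) T_k(x_{> k}, γ)`. -/
def bondMoment (k : Fin (n + 1)) : Matrix (Fin (sk.m k)) (Fin (sk.l k)) ℝ :=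
  Matrix.of fun β γ => ∑ x, sk.S k x β * p x * sk.T k x γ

/-- The sketched tensor at site `k`, in which all variables but `x_k` are sketched; its rows are
indexed by pairs `(β, a)`, where `β` is a left sketch index and `a` is the value of `x_k`. -/
def siteMoment (k : Fin n) : Matrix (Fin (sk.m k.castSucc) × Fin d) (Fin (sk.l k.succ)) ℝ :=
  Matrix.of fun βa γ =>
    ∑ x, sk.S k.castSucc x βa.1 * (if x k = βa.2 then p x else 0) * sk.T k.succ x γ

/-- All sketch functions are bounded by `M` and there are at most `ℓ` of them on either side of every
bond. -/
def BoundedBy (ℓ : ℕ) (M : ℝ) : Prop :=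
  (∀ k, sk.m k ≤ ℓ ∧ sk.l k ≤ ℓ) ∧ (∀ k x β, |sk.S k x β| ≤ M) ∧ (∀ k x γ, |sk.T k x γ| ≤ M)

end Sketch

/-- The `i`-th largest singular value of a matrix (counted from `0`). -/
def singVal {ι κ : Type} [Fintype ι] [Fintype κ] [DecidableEq κ] (Z : Matrix ι κ ℝ) (i : ℕ) : ℝ :=
  (Matrix.toEuclideanLin Z).singularValues i

/-- The sketches preserve the ranks of `p` with constant `c`: at every interior bond, where the
unfolding of `p` has rank `R ≥ 1`, the `R`-th largest singular value of the sketched unfolding is at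
least `c`. -/
def Sketch.PreservesRank {n d : ℕ} (sk : Sketch n d) (p : Config n d → ℝ) (c : ℝ) : Prop :=
  ∀ k : Fin (n + 1), k ≠ 0 → k ≠ Fin.last n → c ≤ singVal (sk.bondMoment p k) (unfoldingRank p k - 1)

/-- `q = V Σ⁻¹`, where `Z ≈ U Σ Vᵀ` is a singular value decomposition of `Z` truncated to the `R`
largest singular values; hence `Z q = U`. -/
def IsTruncatedGauge {ι : Type} [Fintype ι] {l R : ℕ} (Z : Matrix ι (Fin l) ℝ)
    (q : Matrix (Fin l) (Fin R) ℝ) : Prop :=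
  ∃ V : Matrix (Fin l) (Fin R) ℝ, Vᵀ * V = 1 ∧
    (Zᵀ * Z) * V = V * Matrix.diagonal (fun i : Fin R => singVal Z i ^ 2) ∧
    q = V * Matrix.diagonal (fun i : Fin R => (singVal Z i)⁻¹)

/-- `X` is a least squares solution of `A X = B` (normal equations). -/
def IsLeastSquares {m R s : ℕ} (A : Matrix (Fin m) (Fin R) ℝ) (X : Matrix (Fin R) (Fin s) ℝ)
    (B : Matrix (Fin m) (Fin s) ℝ) : Prop :=
  Aᵀ * A * X = Aᵀ * B

/-- `ψ` is an output of the TTNS-Sketch algorithm on a path, for the input tensor `p` (in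
applications, an empirical distribution), the sketches `sk` and the target ranks `R`.

* Sketching: form the site tensors `Z_k` and the bond matrices `W_k`.
* Trimming: for each site but the last one, take a truncated singular value decomposition of `Z_k`,
  with gauge `q` at the bond on its right, so that `B_k = Z_k q` holds the left singular vectors;
  at the last site, `B_n = Z_n`.
* System forming: `A_k = W_k q_k`, and `A = 1` at the left end.
* Solving: the core at every site solves the linear system `A G = B` in the least squares sense. -/
def IsTTNSSketchOutput {n d : ℕ} (sk : Sketch n d) (p : Config n d → ℝ) (R : Fin (n + 1) → ℕ)
    (ψ : MPS n d) : Prop :=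
  (∀ k, ψ.bond k = R k) ∧
  ∃ (q : (k : Fin (n + 1)) → Matrix (Fin (sk.l k)) (Fin (ψ.bond k)) ℝ)
    (A : (k : Fin (n + 1)) → Matrix (Fin (sk.m k)) (Fin (ψ.bond k)) ℝ),
    (∀ k : Fin n, k.succ ≠ Fin.last n → IsTruncatedGauge (sk.siteMoment p k) (q k.succ)) ∧
    (∀ γ α, q (Fin.last n) γ α = 1) ∧
    (∀ β α, A 0 β α = 1) ∧
    (∀ k : Fin (n + 1), k ≠ 0 → A k = sk.bondMoment p k * q k) ∧
    ∀ (k : Fin n) (a : Fin d),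
      IsLeastSquares (A k.castSucc) (ψ.core k a)
        (Matrix.of fun β α => (sk.siteMoment p k * q k.succ) (β, a) α)

/-- The probability mass function of `p`, as a real-valued function. -/
def massFn {n d : ℕ} (p : PMF (Config n d)) : Config n d → ℝ := fun x => (p x).toReal

/-- The empirical distribution of `B` samples. -/
def empirical {n d B : ℕ} (ω : Fin B → Config n d) : Config n d → ℝ :=
  fun x => (Finset.card {b : Fin B | ω b = x} : ℝ) / B

/-- The law of `B` independent samples drawn from `p`. -/
def sampleLaw {n d : ℕ} (p : PMF (Config n d)) (B : ℕ) : Measure (Fin B → Config n d) :=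
  Measure.pi fun _ : Fin B => p.toMeasure

/-- `p` is the density of the Born machine `θ`. -/
def IsBornMachine {n d : ℕ} (p : PMF (Config n d)) (θ : MPS n d) : Prop :=
  ∀ x, massFn p x = θ.bornDensity x

end

/-!
The unfolding of `p` at a bond is a bilinear form of rank `R` between functions of the left and
of the right sites. Sketches that preserve this rank represent every function modulo the kernel
of the form, with bounds that do not depend on the number of sites. In the gauge of the algorithm
they thus give uniformly bounded dual frames `D`, `E` at all bonds, and the cores written in
these frames reproduce `p` exactly.

The singular values kept in the truncation of a perturbed site tensor stay away from zero, so its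
gauge is as good as an exact one. Since the exact cores in that gauge solve the exact linear
systems, least squares stability bounds the error of the computed cores. This error does not get
amplified along the path. Replace exact cores by computed ones from left to right: the products
of the computed cores to the left of a bond are recovered from the hybrid tensor by testing it
against `D`, so their size is controlled by the `ℓ¹` norm of the hybrid, and every replacement
changes this norm by at most a constant times the error of one core. Hence sketched tensors of
accuracy `ε / n` suffice, which Hoeffding's inequality and a union bound provide.

For a Born machine, `p` is up to a factor the square of a tensor whose unfoldings factor through
the bonds, so the unfoldings of `p` factor through pairs of bond indices. Indicator functions of
the rows and columns of a nonsingular `R × R` submatrix of each unfolding are sketches that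
preserve its rank.
-/

noncomputable section

local notation "‖" v "‖₂" => norm (WithLp.toLp 2 v)

/-! ### Least squares in the Euclidean norm -/

section EuclideanNorm

variable {ι κ : Type*} [Fintype ι] [Fintype κ]

theorem norm_toLp_sq_eq_sum (v : ι → ℝ) : ‖v‖₂ ^ 2 = ∑ i, v i ^ 2 :=
  EuclideanSpace.real_norm_sq_eq _

theorem norm_toLp_sq_eq_dotProduct (v : ι → ℝ) : ‖v‖₂ ^ 2 = v ⬝ᵥ v := by
  rw [norm_toLp_sq_eq_sum, dotProduct]
  exact Finset.sum_congr rfl fun i _ => sq (v i)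

theorem abs_apply_le_norm_toLp (v : ι → ℝ) (i : ι) : |v i| ≤ ‖v‖₂ :=
  PiLp.norm_apply_le (WithLp.toLp 2 v) i

theorem norm_toLp_le_norm_add_norm_sub (v w : ι → ℝ) : ‖v‖₂ ≤ ‖w‖₂ + ‖v - w‖₂ :=
  norm_le_norm_add_norm_sub' (WithLp.toLp 2 v) (WithLp.toLp 2 w)

theorem dotProduct_le_norm_mul_norm (v w : ι → ℝ) : v ⬝ᵥ w ≤ ‖v‖₂ * ‖w‖₂ := by
  simpa [EuclideanSpace.inner_toLp_toLp, mul_comm] using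
    real_inner_le_norm (WithLp.toLp 2 w) (WithLp.toLp 2 v)

theorem norm_toLp_le_sum_abs (v : ι → ℝ) : ‖v‖₂ ≤ ∑ i, |v i| := by
  refine le_of_sq_le_sq ?_ (Finset.sum_nonneg fun i _ => abs_nonneg _)
  calc ‖v‖₂ ^ 2 = ∑ i, |v i| ^ 2 := by simp only [norm_toLp_sq_eq_sum, sq_abs]
    _ ≤ (∑ i, |v i|) ^ 2 := Finset.sum_sq_le_sq_sum_of_nonneg fun i _ => abs_nonneg _

theorem norm_toLp_le_card_mul {v : ι → ℝ} {b : ℝ} (h : ∀ i, |v i| ≤ b) :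
    ‖v‖₂ ≤ Fintype.card ι * b :=
  (norm_toLp_le_sum_abs v).trans ((Finset.sum_le_sum fun i _ => h i).trans (by simp))

theorem abs_dotProduct_le {a v : ι → ℝ} {e b : ℝ} (ha : ∀ i, |a i| ≤ e) (hv : ∀ i, |v i| ≤ b) :
    |a ⬝ᵥ v| ≤ Fintype.card ι * (e * b) :=
  calc |a ⬝ᵥ v| ≤ ∑ i, |a i * v i| := Finset.abs_sum_le_sum_abs _ _
    _ ≤ ∑ _i : ι, e * b := Finset.sum_le_sum fun i _ => by
        rw [abs_mul]
        exact mul_le_mul (ha i) (hv i) (abs_nonneg _) ((abs_nonneg _).trans (ha i))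
    _ = Fintype.card ι * (e * b) := by simp

theorem norm_mulVec_le {E : Matrix ι κ ℝ} {e : ℝ} (h : ∀ i j, |E i j| ≤ e) (v : κ → ℝ) :
    ‖E *ᵥ v‖₂ ≤ Fintype.card ι * (Fintype.card κ * (e * ‖v‖₂)) :=
  norm_toLp_le_card_mul fun i => abs_dotProduct_le (h i) (abs_apply_le_norm_toLp v)

theorem abs_apply_le_norm_mulVec_single [DecidableEq κ] (E : Matrix ι κ ℝ) (i : ι) (j : κ) :
    |E i j| ≤ ‖E *ᵥ Pi.single j 1‖₂ := by
  simpa using abs_apply_le_norm_toLp (E *ᵥ Pi.single j 1) i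

theorem norm_toLp_single_one [DecidableEq κ] (j : κ) :
    ‖(Pi.single j 1 : κ → ℝ)‖₂ = 1 :=
  (PiLp.norm_single 2 (fun _ : κ => ℝ) j 1).trans norm_one

theorem mulVec_dotProduct_mulVec (Z : Matrix ι κ ℝ) (u v : κ → ℝ) :
    (Z *ᵥ u) ⬝ᵥ (Z *ᵥ v) = u ⬝ᵥ ((Zᵀ * Z) *ᵥ v) := by
  rw [← Matrix.mulVec_mulVec, Matrix.dotProduct_mulVec u, Matrix.vecMul_transpose]

theorem norm_mulVec_of_transpose_mul_self [DecidableEq κ] {V : Matrix ι κ ℝ} (hV : Vᵀ * V = 1)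
    (u : κ → ℝ) : ‖V *ᵥ u‖₂ = ‖u‖₂ := by
  rw [← sq_eq_sq₀ (norm_nonneg _) (norm_nonneg _), norm_toLp_sq_eq_dotProduct,
    norm_toLp_sq_eq_dotProduct, mulVec_dotProduct_mulVec, hV, Matrix.one_mulVec]

end EuclideanNorm

/-- The matrix `A` expands Euclidean norms by a factor of at least `τ`; for `τ > 0` this says that
`A` has full column rank and least singular value at least `τ`. -/
def BoundedBelow {ι κ : Type*} [Fintype ι] [Fintype κ] (A : Matrix ι κ ℝ) (τ : ℝ) : Prop :=
  ∀ u, τ * ‖u‖₂ ≤ ‖A *ᵥ u‖₂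

namespace BoundedBelow

variable {ι κ : Type*} [Fintype ι] [Fintype κ] {A : Matrix ι κ ℝ} {τ : ℝ}

theorem mono {τ' : ℝ} (hA : BoundedBelow A τ) (h : τ' ≤ τ) : BoundedBelow A τ' := fun u =>
  (mul_le_mul_of_nonneg_right h (norm_nonneg _)).trans (hA u)

theorem of_norm_sub_mulVec_le {A' : Matrix ι κ ℝ} {s : ℝ} (hA : BoundedBelow A τ)
    (h : ∀ u, ‖(A' - A) *ᵥ u‖₂ ≤ s * ‖u‖₂) : BoundedBelow A' (τ - s) := fun u => by
  have htriangle := norm_toLp_le_norm_add_norm_sub (A *ᵥ u) (A' *ᵥ u)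
  rw [WithLp.toLp_sub, norm_sub_rev, ← WithLp.toLp_sub, ← Matrix.sub_mulVec] at htriangle
  linarith [hA u, h u]

theorem eq_zero_of_mulVec_eq_zero (hA : BoundedBelow A τ) (hτ : 0 < τ) {u : κ → ℝ}
    (hu : A *ᵥ u = 0) : u = 0 := by
  have h := hA u
  rw [hu, WithLp.toLp_zero, norm_zero] at h
  simpa using le_antisymm (nonpos_of_mul_nonpos_right h hτ) (norm_nonneg _)

theorem norm_le_of_normal_equation (hA : BoundedBelow A τ) {u : κ → ℝ} {r : ι → ℝ}
    (h : (Aᵀ * A) *ᵥ u = Aᵀ *ᵥ r) : τ * ‖u‖₂ ≤ ‖r‖₂ := by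
  refine (hA u).trans ?_
  have hsq : ‖A *ᵥ u‖₂ * ‖A *ᵥ u‖₂ ≤ ‖A *ᵥ u‖₂ * ‖r‖₂ := by
    rw [← sq, norm_toLp_sq_eq_dotProduct, mulVec_dotProduct_mulVec, h, Matrix.dotProduct_mulVec,
      Matrix.vecMul_transpose]
    exact dotProduct_le_norm_mul_norm _ _
  rcases (norm_nonneg (WithLp.toLp 2 (A *ᵥ u))).eq_or_lt with h0 | h0
  · rw [← h0]
    exact norm_nonneg _
  · exact le_of_mul_le_mul_left hsq h0

theorem isUnit_transpose_mul_self [DecidableEq κ] (hA : BoundedBelow A τ) (hτ : 0 < τ) :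
    IsUnit (Aᵀ * A) := by
  refine Matrix.mulVec_injective_iff_isUnit.1 ((injective_iff_map_eq_zero (Aᵀ * A).mulVecLin).2 ?_)
  intro u hu
  have h := hA.norm_le_of_normal_equation (u := u) (r := 0) (by rw [Matrix.mulVec_zero]; exact hu)
  rw [WithLp.toLp_zero, norm_zero] at h
  simpa using le_antisymm (nonpos_of_mul_nonpos_right h hτ) (norm_nonneg _)

theorem exists_leftInverse [DecidableEq κ] (hA : BoundedBelow A τ) (hτ : 0 < τ) :
    ∃ P : Matrix κ ι ℝ, P * A = 1 ∧ ∀ α i, |P α i| ≤ 1 / τ := by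
  classical
  have hdet := (Matrix.isUnit_iff_isUnit_det _).1 (hA.isUnit_transpose_mul_self hτ)
  refine ⟨(Aᵀ * A)⁻¹ * Aᵀ, by rw [Matrix.mul_assoc, Matrix.nonsing_inv_mul _ hdet],
    fun α i => ?_⟩
  have hnormal : (Aᵀ * A) *ᵥ (((Aᵀ * A)⁻¹ * Aᵀ) *ᵥ Pi.single i 1) = Aᵀ *ᵥ Pi.single i 1 := by
    rw [Matrix.mulVec_mulVec, ← Matrix.mul_assoc, Matrix.mul_nonsing_inv _ hdet, Matrix.one_mul]
  have hcolumn := hA.norm_le_of_normal_equation hnormal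
  rw [norm_toLp_single_one] at hcolumn
  exact (abs_apply_le_norm_mulVec_single _ α i).trans ((le_div_iff₀' hτ).2 hcolumn)

end BoundedBelow

theorem boundedBelow_of_apply_eq_one {m R : ℕ} (hm : m = 1) (hR : R = 1)
    {A : Matrix (Fin m) (Fin R) ℝ} (hA : ∀ i j, A i j = 1) : BoundedBelow A 1 := fun u => by
  subst hm hR
  have hAu : A *ᵥ u = u := by
    ext i
    simp [Matrix.mulVec, dotProduct, hA, Subsingleton.elim i 0]
  rw [hAu, one_mul]

section LeastSquares

variable {m R ℓ : ℕ} {A A' : Matrix (Fin m) (Fin R) ℝ} {τ a : ℝ}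

theorem BoundedBelow.half_of_abs_sub_le (hA : BoundedBelow A τ) (hm : m ≤ ℓ) (hR : R ≤ ℓ)
    (h : ∀ i j, |A' i j - A i j| ≤ a) (ha : 0 ≤ a) (hsmall : ℓ * (ℓ * a) ≤ τ / 2) :
    BoundedBelow A' (τ / 2) := by
  refine (hA.of_norm_sub_mulVec_le (s := ℓ * (ℓ * a)) fun u => ?_).mono (by linarith)
  calc ‖(A' - A) *ᵥ u‖₂ ≤ m * (R * (a * ‖u‖₂)) := by
        simpa using norm_mulVec_le (E := A' - A) h u
    _ ≤ ℓ * (ℓ * (a * ‖u‖₂)) := by gcongr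
    _ = ℓ * (ℓ * a) * ‖u‖₂ := by ring

theorem BoundedBelow.norm_leastSquares_sub_le (hA : BoundedBelow A τ) (hm : m ≤ ℓ) (hR : R ≤ ℓ)
    (hAA : ∀ i j, |A' i j - A i j| ≤ a) (ha : 0 ≤ a) (hsmall : ℓ * (ℓ * a) ≤ τ / 2)
    {b b' : Fin m → ℝ} (hbb : ∀ i, |b' i - b i| ≤ a) {g g' : Fin R → ℝ} {G : ℝ}
    (hg : ∀ j, |g j| ≤ G) (hG : 0 ≤ G) (hexact : A *ᵥ g = b)
    (hls : (A'ᵀ * A') *ᵥ g' = A'ᵀ *ᵥ b') :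
    τ / 2 * ‖g' - g‖₂ ≤ ℓ * (a + ℓ * (a * G)) := by
  have hnormal : (A'ᵀ * A') *ᵥ (g' - g) = A'ᵀ *ᵥ (b' - A' *ᵥ g) := by
    rw [Matrix.mulVec_sub, hls, Matrix.mulVec_sub, Matrix.mulVec_mulVec]
  have hresidual : ∀ i, |(b' - A' *ᵥ g) i| ≤ a + ℓ * (a * G) := fun i => by
    have hsplit : (b' - A' *ᵥ g) i = (b' i - b i) - ((A' - A) *ᵥ g) i := by
      rw [Matrix.sub_mulVec, hexact]
      simp
    rw [hsplit]
    refine (abs_sub _ _).trans (add_le_add (hbb i) ((abs_dotProduct_le (hAA i) hg).trans ?_))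
    rw [Fintype.card_fin]
    gcongr
  calc τ / 2 * ‖g' - g‖₂ ≤ ‖b' - A' *ᵥ g‖₂ :=
        (hA.half_of_abs_sub_le hm hR hAA ha hsmall).norm_le_of_normal_equation hnormal
    _ ≤ m * (a + ℓ * (a * G)) := by simpa using norm_toLp_le_card_mul hresidual
    _ ≤ ℓ * (a + ℓ * (a * G)) := by gcongr

end LeastSquares

theorem exists_mulVec_eq_of_rank_eq {ι κ : Type*} [Fintype κ] {R : ℕ}
    {U : Matrix ι κ ℝ} {X : Matrix κ (Fin R) ℝ} (hR : U.rank = R)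
    (hX : ∀ u, U *ᵥ (X *ᵥ u) = 0 → u = 0) (g : κ → ℝ) : ∃ u, U *ᵥ g = U *ᵥ (X *ᵥ u) := by
  have hle : LinearMap.range (U * X).mulVecLin ≤ LinearMap.range U.mulVecLin := by
    rw [Matrix.mulVecLin_mul]
    exact LinearMap.range_comp_le_range _ _
  have hinj : Function.Injective (U * X).mulVecLin := by
    refine (injective_iff_map_eq_zero _).2 fun u hu => hX u ?_
    rwa [Matrix.mulVecLin_apply, ← Matrix.mulVec_mulVec] at hu
  have heq : LinearMap.range (U * X).mulVecLin = LinearMap.range U.mulVecLin :=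
    Submodule.eq_of_le_of_finrank_eq hle (by
      rw [LinearMap.finrank_range_of_inj hinj]
      simpa [Matrix.rank] using hR.symm)
  obtain ⟨u, hu⟩ : U *ᵥ g ∈ LinearMap.range (U * X).mulVecLin := heq ▸ ⟨g, rfl⟩
  exact ⟨u, by rw [← hu, Matrix.mulVecLin_apply, Matrix.mulVec_mulVec]⟩

/-! ### Singular values and truncated gauges -/

section SingularValues

variable {ι : Type} [Fintype ι] {l R : ℕ}

theorem singVal_nonneg (Z : Matrix ι (Fin l) ℝ) (i : ℕ) : 0 ≤ singVal Z i :=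
  LinearMap.singularValues_nonneg _ _

theorem singVal_antitone (Z : Matrix ι (Fin l) ℝ) : Antitone (singVal Z) :=
  LinearMap.singularValues_antitone _

theorem lt_of_singVal_pos {Z : Matrix ι (Fin l) ℝ} {i : ℕ} (h : 0 < singVal Z i) : i < l := by
  by_contra hi
  exact h.ne' (LinearMap.singularValues_of_finrank_le _ (by simpa using hi))

theorem singVal_pos_of_lt_rank {Z : Matrix ι (Fin l) ℝ} {i : ℕ} (h : i < Z.rank) :
    0 < singVal Z i := by
  refine (LinearMap.singularValues_pos_iff_lt_finrank_range _).2 ?_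
  rwa [Matrix.rank_eq_finrank_range_toLin Z (EuclideanSpace.basisFun ι ℝ).toBasis
    (EuclideanSpace.basisFun (Fin l) ℝ).toBasis, ← Matrix.toEuclideanLin_eq_toLin_orthonormal] at h

/-- The columns of `V` are orthonormal right singular vectors of `Z` for its `R` largest singular
values. -/
structure IsRightSingular (Z : Matrix ι (Fin l) ℝ) (V : Matrix (Fin l) (Fin R) ℝ) : Prop where
  orthonormal : Vᵀ * V = 1
  gram_mul : (Zᵀ * Z) * V = V * Matrix.diagonal (fun i : Fin R => singVal Z i ^ 2)

theorem exists_isRightSingular_square (Z : Matrix ι (Fin l) ℝ) :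
    ∃ V : Matrix (Fin l) (Fin l) ℝ, IsRightSingular Z V := by
  classical
  let T := Matrix.toEuclideanLin Z
  let b := T.isSymmetric_adjoint_comp_self.eigenvectorBasis finrank_euclideanSpace_fin
  refine ⟨Matrix.of fun i j => b j i, ?_, ?_⟩
  · ext i j
    rw [Matrix.mul_apply, Matrix.one_apply, ← orthonormal_iff_ite.1 b.orthonormal i j,
      EuclideanSpace.inner_eq_star_dotProduct, dotProduct]
    exact Finset.sum_congr rfl fun k _ => by simp [mul_comm]
  · ext i j
    have heigen : LinearMap.adjoint T (T (b j)) = (T.singularValues j ^ 2 : ℝ) • b j := by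
      have h := T.isSymmetric_adjoint_comp_self.apply_eigenvectorBasis finrank_euclideanSpace_fin j
      rwa [← T.sq_singularValues_fin finrank_euclideanSpace_fin] at h
    rw [← Matrix.toEuclideanLin_conjTranspose_eq_adjoint, Matrix.toLpLin_apply,
      Matrix.toLpLin_apply] at heigen
    have hcoord := congrArg (fun v : EuclideanSpace ℝ (Fin l) => v i) heigen
    simp only [Matrix.mulVec_mulVec, Matrix.conjTranspose_eq_transpose_of_trivial] at hcoord
    rw [Matrix.mul_diagonal]
    exact hcoord.trans (mul_comm _ _)

theorem exists_isRightSingular (Z : Matrix ι (Fin l) ℝ) (hR : R ≤ l) :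
    ∃ V : Matrix (Fin l) (Fin R) ℝ, IsRightSingular Z V := by
  obtain ⟨V, hV⟩ := exists_isRightSingular_square Z
  refine ⟨V.submatrix id (Fin.castLE hR), ?_, ?_⟩
  · ext i j
    have := congrFun (congrFun hV.orthonormal (Fin.castLE hR i)) (Fin.castLE hR j)
    simpa [Matrix.mul_apply, Matrix.one_apply] using this
  · ext i j
    have := congrFun (congrFun hV.gram_mul i) (Fin.castLE hR j)
    rw [Matrix.mul_diagonal] at this ⊢
    exact this

theorem exists_isTruncatedGauge (Z : Matrix ι (Fin l) ℝ) (hR : R ≤ l) :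
    ∃ q : Matrix (Fin l) (Fin R) ℝ, IsTruncatedGauge Z q := by
  obtain ⟨V, hV⟩ := exists_isRightSingular Z hR
  exact ⟨_, V, hV.orthonormal, hV.gram_mul, rfl⟩

variable {Z : Matrix ι (Fin l) ℝ} {V : Matrix (Fin l) (Fin R) ℝ}

theorem IsRightSingular.norm_mulVec_mulVec_sq (hV : IsRightSingular Z V) (u : Fin R → ℝ) :
    ‖Z *ᵥ (V *ᵥ u)‖₂ ^ 2 = ∑ i : Fin R, singVal Z i ^ 2 * u i ^ 2 := by
  rw [norm_toLp_sq_eq_dotProduct, mulVec_dotProduct_mulVec, Matrix.mulVec_mulVec, hV.gram_mul,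
    ← Matrix.mulVec_mulVec, Matrix.dotProduct_mulVec, ← Matrix.mulVec_transpose,
    Matrix.mulVec_mulVec, hV.orthonormal, Matrix.one_mulVec, dotProduct]
  exact Finset.sum_congr rfl fun i _ => by rw [Matrix.mulVec_diagonal]; ring

theorem IsRightSingular.le_norm_mulVec_mulVec (hV : IsRightSingular Z V) {s : ℝ} (hs : 0 ≤ s)
    (hsv : s ≤ singVal Z (R - 1)) (u : Fin R → ℝ) : s * ‖u‖₂ ≤ ‖Z *ᵥ (V *ᵥ u)‖₂ := by
  refine le_of_sq_le_sq ?_ (norm_nonneg _)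
  rw [hV.norm_mulVec_mulVec_sq, mul_pow, norm_toLp_sq_eq_sum, Finset.mul_sum]
  refine Finset.sum_le_sum fun i _ => mul_le_mul_of_nonneg_right ?_ (sq_nonneg _)
  exact pow_le_pow_left₀ hs (hsv.trans (singVal_antitone Z (Nat.le_sub_one_of_lt i.2))) 2

theorem exists_isometry_of_le_singVal {c : ℝ} (hc : 0 < c) (h : c ≤ singVal Z (R - 1)) :
    ∃ Y : Matrix (Fin l) (Fin R) ℝ, (∀ u, ‖Y *ᵥ u‖₂ = ‖u‖₂) ∧
      ∀ u, c * ‖u‖₂ ≤ ‖Z *ᵥ (Y *ᵥ u)‖₂ := by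
  have hR : R ≤ l := Nat.le_of_pred_lt (lt_of_singVal_pos (hc.trans_le h))
  obtain ⟨V, hV⟩ := exists_isRightSingular Z hR
  exact ⟨V, norm_mulVec_of_transpose_mul_self hV.orthonormal, hV.le_norm_mulVec_mulVec hc.le h⟩

/-- The lower bound in the Courant-Fischer theorem: some vector of the range of `Y` is orthogonal to
the first `R - 1` right singular vectors. -/
theorem le_singVal_of_isometry (hR : 1 ≤ R) {t : ℝ} {Y : Matrix (Fin l) (Fin R) ℝ}
    (hY : ∀ u, ‖Y *ᵥ u‖₂ = ‖u‖₂) (h : ∀ u, t * ‖u‖₂ ≤ ‖Z *ᵥ (Y *ᵥ u)‖₂) :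
    t ≤ singVal Z (R - 1) := by
  obtain ⟨V, hV⟩ := exists_isRightSingular_square Z
  have hRl : R ≤ l := by
    have hinj : Function.Injective Y.mulVecLin :=
      (injective_iff_map_eq_zero _).2 fun u hu => by
        have h0 : ‖u‖₂ = 0 := by rw [← hY, ← Y.mulVecLin_apply, hu, WithLp.toLp_zero, norm_zero]
        simpa using h0
    simpa using LinearMap.finrank_le_finrank_of_injective hinj
  let φ : (Fin R → ℝ) →ₗ[ℝ] (Fin (R - 1) → ℝ) :=
    LinearMap.funLeft ℝ ℝ (Fin.castLE (R.pred_le.trans hRl)) ∘ₗ (Vᵀ * Y).mulVecLin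
  obtain ⟨u, hu, hu0⟩ := Submodule.exists_mem_ne_zero_of_ne_bot
    (LinearMap.ker_ne_bot_of_finrank_lt (f := φ) (by simp; omega))
  have hpos : 0 < ‖u‖₂ := by simpa using hu0
  have hYu : Y *ᵥ u = V *ᵥ ((Vᵀ * Y) *ᵥ u) := by
    rw [Matrix.mulVec_mulVec, ← Matrix.mul_assoc, mul_eq_one_comm.1 hV.orthonormal, Matrix.one_mul]
  have hnorm : ‖(Vᵀ * Y) *ᵥ u‖₂ = ‖u‖₂ := by
    rw [← norm_mulVec_of_transpose_mul_self hV.orthonormal, ← hYu, hY]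
  refine le_of_mul_le_mul_right ((h u).trans (le_of_sq_le_sq ?_ ?_)) hpos
  · rw [hYu, hV.norm_mulVec_mulVec_sq, mul_pow, ← hnorm, norm_toLp_sq_eq_sum, Finset.mul_sum]
    refine Finset.sum_le_sum fun i _ => ?_
    rcases lt_or_ge (i : ℕ) (R - 1) with hi | hi
    · have horth : ((Vᵀ * Y) *ᵥ u) i = 0 := congrFun (LinearMap.mem_ker.1 hu) ⟨i, hi⟩
      simp [horth]
    · gcongr
      exacts [singVal_nonneg _ _, singVal_antitone Z hi]
  · exact mul_nonneg (singVal_nonneg _ _) hpos.le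

end SingularValues

namespace IsTruncatedGauge

variable {ι : Type} [Fintype ι] {l R : ℕ} {Z : Matrix ι (Fin l) ℝ} {q : Matrix (Fin l) (Fin R) ℝ}
  {s : ℝ}

theorem norm_mulVec_le (hq : IsTruncatedGauge Z q) (hs : 0 < s) (hsv : s ≤ singVal Z (R - 1))
    (u : Fin R → ℝ) : ‖q *ᵥ u‖₂ ≤ 1 / s * ‖u‖₂ := by
  obtain ⟨V, horth, -, rfl⟩ := hq
  rw [← Matrix.mulVec_mulVec, norm_mulVec_of_transpose_mul_self horth]
  refine le_of_sq_le_sq ?_ (by positivity)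
  rw [mul_pow, norm_toLp_sq_eq_sum, norm_toLp_sq_eq_sum, Finset.mul_sum]
  refine Finset.sum_le_sum fun i _ => ?_
  have hi : s ≤ singVal Z i := hsv.trans (singVal_antitone Z (Nat.le_sub_one_of_lt i.2))
  have hi0 : 0 < singVal Z i := hs.trans_le hi
  rw [Matrix.mulVec_diagonal, mul_pow, ← one_div]
  gcongr

theorem norm_mulVec_mulVec (hq : IsTruncatedGauge Z q) (hs : 0 < s) (hsv : s ≤ singVal Z (R - 1))
    (u : Fin R → ℝ) : ‖Z *ᵥ (q *ᵥ u)‖₂ = ‖u‖₂ := by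
  obtain ⟨V, horth, hgram, rfl⟩ := hq
  rw [← sq_eq_sq₀ (norm_nonneg _) (norm_nonneg _), ← Matrix.mulVec_mulVec,
    IsRightSingular.norm_mulVec_mulVec_sq ⟨horth, hgram⟩, norm_toLp_sq_eq_sum]
  refine Finset.sum_congr rfl fun i _ => ?_
  have hi : 0 < singVal Z i :=
    hs.trans_le (hsv.trans (singVal_antitone Z (Nat.le_sub_one_of_lt i.2)))
  rw [Matrix.mulVec_diagonal]
  field_simp

theorem abs_apply_le (hq : IsTruncatedGauge Z q) (hs : 0 < s) (hsv : s ≤ singVal Z (R - 1))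
    (γ : Fin l) (α : Fin R) : |q γ α| ≤ 1 / s := by
  have h := hq.norm_mulVec_le hs hsv (Pi.single α 1)
  rw [norm_toLp_single_one, mul_one] at h
  exact (abs_apply_le_norm_mulVec_single q γ α).trans h

theorem half_norm_le (hq : IsTruncatedGauge Z q) (hs : 0 < s) (hsv : s ≤ singVal Z (R - 1))
    {Z₀ : Matrix ι (Fin l) ℝ} (hZ : ∀ v, ‖(Z - Z₀) *ᵥ v‖₂ ≤ s / 2 * ‖v‖₂) (u : Fin R → ℝ) :
    1 / 2 * ‖u‖₂ ≤ ‖Z₀ *ᵥ (q *ᵥ u)‖₂ := by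
  have htriangle := norm_toLp_le_norm_add_norm_sub (Z *ᵥ (q *ᵥ u)) (Z₀ *ᵥ (q *ᵥ u))
  rw [← Matrix.sub_mulVec, hq.norm_mulVec_mulVec hs hsv] at htriangle
  have herror : ‖(Z - Z₀) *ᵥ (q *ᵥ u)‖₂ ≤ 1 / 2 * ‖u‖₂ :=
    calc ‖(Z - Z₀) *ᵥ (q *ᵥ u)‖₂ ≤ s / 2 * (1 / s * ‖u‖₂) :=
          (hZ _).trans (by gcongr; exact hq.norm_mulVec_le hs hsv u)
      _ = 1 / 2 * ‖u‖₂ := by field_simp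
  linarith

end IsTruncatedGauge

/-! ### The bilinear form of an unfolding -/

section Pairing

variable {n d : ℕ}

/-- The sites to the left of the bond `k`. -/
abbrev leftSites (k : Fin (n + 1)) : Set (Fin n) := {i : Fin n | i.castSucc < k}

/-- The sites to the right of the bond `k`. -/
abbrev rightSites (k : Fin (n + 1)) : Set (Fin n) := {i : Fin n | ¬ i.castSucc < k}

/-- The bilinear form `∑_x f(x) p(x) g(x)`. For functions `f` of the left sites and `g` of the right
sites of a bond, it is the bilinear form of the unfolding of `p` at that bond. -/
def pairing (p f g : Config n d → ℝ) : ℝ := ∑ x, f x * p x * g x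

theorem pairing_const_mul_left (p f g : Config n d → ℝ) (a : ℝ) :
    pairing p (fun x => a * f x) g = a * pairing p f g := by
  simp only [pairing, Finset.mul_sum, mul_assoc]

theorem pairing_dotProduct {ι : Type*} [Fintype ι] (p f : Config n d → ℝ)
    (D : Config n d → ι → ℝ) (u : ι → ℝ) :
    pairing p f (fun x => D x ⬝ᵥ u) = (fun i => pairing p f (D · i)) ⬝ᵥ u := by
  simp only [pairing, dotProduct, Finset.mul_sum, Finset.sum_mul, ← mul_assoc]
  exact Finset.sum_comm

theorem dotProduct_pairing {ι : Type*} [Fintype ι] (p g : Config n d → ℝ)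
    (S : Config n d → ι → ℝ) (v : ι → ℝ) :
    pairing p (fun x => v ⬝ᵥ S x) g = v ⬝ᵥ (fun i => pairing p (S · i) g) := by
  simp only [pairing, dotProduct, Finset.mul_sum, Finset.sum_mul, ← mul_assoc]
  exact Finset.sum_comm

theorem abs_pairing_le {p f g : Config n d → ℝ} (hp : ∀ x, 0 ≤ p x) (hp1 : ∑ x, p x = 1)
    {a b : ℝ} (hf : ∀ x, |f x| ≤ a) (hg : ∀ x, |g x| ≤ b) (ha : 0 ≤ a) :
    |pairing p f g| ≤ a * b :=
  calc |pairing p f g| ≤ ∑ x, |f x * p x * g x| := Finset.abs_sum_le_sum_abs _ _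
    _ = ∑ x, |f x| * |g x| * p x := by
        simp only [abs_mul, abs_of_nonneg (hp _), mul_right_comm]
    _ ≤ ∑ x, a * b * p x := Finset.sum_le_sum fun x _ => mul_le_mul_of_nonneg_right
        (mul_le_mul (hf x) (hg x) (abs_nonneg _) ha) (hp x)
    _ = a * b := by rw [← Finset.mul_sum, hp1, mul_one]

theorem dependsOn_dotProduct {ι : Type*} [Fintype ι] {D : Config n d → ι → ℝ} {s : Set (Fin n)}
    (hD : DependsOn D s) (u : ι → ℝ) : DependsOn (fun x => D x ⬝ᵥ u) s :=
  fun x y h => by simp only [hD h]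

theorem dependsOn_apply {ι : Type*} {D : Config n d → ι → ℝ} {s : Set (Fin n)}
    (hD : DependsOn D s) (i : ι) : DependsOn (D · i) s :=
  fun x y h => by simp only [hD h]

/-- A configuration is a pair of a configuration of the left sites and one of the right sites. -/
def splitAt (k : Fin (n + 1)) : Config n d ≃
    ({i : Fin n // i.castSucc < k} → Fin d) × ({i : Fin n // ¬ i.castSucc < k} → Fin d) :=
  Equiv.piEquivPiSubtypeProd (fun i : Fin n => i.castSucc < k) (fun _ => Fin d)

theorem splitAt_symm_left {k : Fin (n + 1)} (y : {i : Fin n // i.castSucc < k} → Fin d)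
    (z : {i : Fin n // ¬ i.castSucc < k} → Fin d) {i : Fin n} (h : i.castSucc < k) :
    (splitAt k).symm (y, z) i = y ⟨i, h⟩ := dif_pos h

theorem splitAt_symm_right {k : Fin (n + 1)} (y : {i : Fin n // i.castSucc < k} → Fin d)
    (z : {i : Fin n // ¬ i.castSucc < k} → Fin d) {i : Fin n} (h : ¬ i.castSucc < k) :
    (splitAt k).symm (y, z) i = z ⟨i, h⟩ := dif_neg h

theorem unfolding_splitAt (p : Config n d → ℝ) (k : Fin (n + 1)) (x : Config n d) :
    unfolding p k (splitAt k x).1 (splitAt k x).2 = p x :=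
  congrArg p ((splitAt k).symm_apply_apply x)

theorem pairing_eq_dotProduct_unfolding (p : Config n d → ℝ) (k : Fin (n + 1)) (x₀ : Config n d)
    {f g : Config n d → ℝ} (hf : DependsOn f (leftSites k)) (hg : DependsOn g (rightSites k)) :
    pairing p f g = (fun y => f ((splitAt k).symm (y, (splitAt k x₀).2))) ⬝ᵥ
      (unfolding p k *ᵥ fun z => g ((splitAt k).symm ((splitAt k x₀).1, z))) := by
  rw [pairing, ← (splitAt k).symm.sum_comp, Fintype.sum_prod_type]
  refine Finset.sum_congr rfl fun y _ => ?_
  rw [Matrix.mulVec, dotProduct, Finset.mul_sum]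
  refine Finset.sum_congr rfl fun z _ => ?_
  have hfy : f ((splitAt k).symm (y, z)) = f ((splitAt k).symm (y, (splitAt k x₀).2)) :=
    hf fun i hi => by rw [splitAt_symm_left _ _ hi, splitAt_symm_left _ _ hi]
  have hgz : g ((splitAt k).symm (y, z)) = g ((splitAt k).symm ((splitAt k x₀).1, z)) :=
    hg fun i hi => by rw [splitAt_symm_right _ _ hi, splitAt_symm_right _ _ hi]
  rw [hfy, hgz, mul_assoc]
  rfl

/-- By nondegeneracy the unfolding and its product with `D` have the same rank, hence the same
column space. -/
theorem exists_pairing_eq_dotProduct {p : Config n d → ℝ} {k : Fin (n + 1)} {R : ℕ}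
    (hR : unfoldingRank p k = R) {D : Config n d → Fin R → ℝ} (hD : DependsOn D (rightSites k))
    (hinj : ∀ u, (∀ f, DependsOn f (leftSites k) → pairing p f (fun x => D x ⬝ᵥ u) = 0) → u = 0)
    {g : Config n d → ℝ} (hg : DependsOn g (rightSites k)) :
    ∃ u : Fin R → ℝ, ∀ f, DependsOn f (leftSites k) →
      pairing p f g = pairing p f (fun x => D x ⬝ᵥ u) := by
  rcases isEmpty_or_nonempty (Config n d) with hempty | ⟨⟨x₀⟩⟩
  · exact ⟨0, fun f _ => by simp [pairing]⟩
  let X := Matrix.of fun z => D ((splitAt k).symm ((splitAt k x₀).1, z))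
  have hpairing : ∀ f, DependsOn f (leftSites k) → ∀ u, pairing p f (fun x => D x ⬝ᵥ u) =
      (fun y => f ((splitAt k).symm (y, (splitAt k x₀).2))) ⬝ᵥ (unfolding p k *ᵥ (X *ᵥ u)) :=
    fun f hf u => pairing_eq_dotProduct_unfolding p k x₀ hf (dependsOn_dotProduct hD u)
  obtain ⟨u, hu⟩ := exists_mulVec_eq_of_rank_eq (X := X) hR
    (fun u hu => hinj u fun f hf => by rw [hpairing f hf, hu, dotProduct_zero])
    (fun z => g ((splitAt k).symm ((splitAt k x₀).1, z)))
  exact ⟨u, fun f hf => by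
    rw [hpairing f hf, ← hu, pairing_eq_dotProduct_unfolding p k x₀ hf hg]⟩

theorem unfoldingRank_pos {p : Config n d → ℝ} (hp : p ≠ 0) (k : Fin (n + 1)) :
    1 ≤ unfoldingRank p k := by
  rw [Nat.one_le_iff_ne_zero, unfoldingRank, Ne, Matrix.rank, Submodule.finrank_eq_zero,
    LinearMap.range_eq_bot]
  intro hzero
  refine hp (funext fun x => ?_)
  have hentry := congrFun (LinearMap.congr_fun hzero (Pi.single (splitAt k x).2 1)) (splitAt k x).1
  rwa [Matrix.mulVecLin_apply, Matrix.mulVec_single_one, Matrix.col_apply,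
    unfolding_splitAt] at hentry

theorem unfoldingRank_zero {p : Config n d → ℝ} (hp : p ≠ 0) : unfoldingRank p 0 = 1 := by
  refine le_antisymm ?_ (unfoldingRank_pos hp 0)
  have : IsEmpty {i : Fin n // i.castSucc < 0} := ⟨fun i => Fin.not_lt_zero _ i.2⟩
  exact (Matrix.rank_le_card_height _).trans (by simp)

theorem unfoldingRank_last {p : Config n d → ℝ} (hp : p ≠ 0) :
    unfoldingRank p (Fin.last n) = 1 := by
  refine le_antisymm ?_ (unfoldingRank_pos hp _)
  have : IsEmpty {i : Fin n // ¬ i.castSucc < Fin.last n} :=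
    ⟨fun i => i.2 (Fin.castSucc_lt_last _)⟩
  exact (Matrix.rank_le_card_width _).trans (by simp)

end Pairing

section SketchMoments

variable {n d : ℕ}

theorem Sketch.bondMoment_mulVec (sk : Sketch n d) (p : Config n d → ℝ) (k : Fin (n + 1))
    (w : Fin (sk.l k) → ℝ) :
    sk.bondMoment p k *ᵥ w = fun β => pairing p (sk.S k · β) (fun x => sk.T k x ⬝ᵥ w) := by
  ext β
  rw [pairing_dotProduct]
  rfl

/-- The indicator function of `x_k = a`. -/
def siteIndicator (k : Fin n) (a : Fin d) (x : Config n d) : ℝ := if x k = a then 1 else 0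

theorem abs_siteIndicator_mul_le (k : Fin n) (a : Fin d) (x : Config n d) (t : ℝ) :
    |siteIndicator k a x * t| ≤ |t| := by
  unfold siteIndicator
  split_ifs <;> simp

theorem dependsOn_siteIndicator_mul {k : Fin n} {a : Fin d} {g : Config n d → ℝ}
    (hg : DependsOn g (rightSites k.succ)) :
    DependsOn (fun x => siteIndicator k a x * g x) (rightSites k.castSucc) := fun x y h => by
  have hk : x k = y k := h k (lt_irrefl _)
  have hgxy : g x = g y := hg fun i hi => h i fun hlt => hi (hlt.trans Fin.castSucc_lt_succ)
  simp only [siteIndicator, hk, hgxy]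

theorem dependsOn_mul_siteIndicator {k : Fin n} {a : Fin d} {f : Config n d → ℝ}
    (hf : DependsOn f (leftSites k.castSucc)) :
    DependsOn (fun x => f x * siteIndicator k a x) (leftSites k.succ) := fun x y h => by
  have hk : x k = y k := h k Fin.castSucc_lt_succ
  have hfxy : f x = f y := hf fun i hi => h i (lt_trans hi Fin.castSucc_lt_succ)
  simp only [siteIndicator, hk, hfxy]

theorem pairing_mul_siteIndicator (p f g : Config n d → ℝ) (k : Fin n) (a : Fin d) :
    pairing p (fun x => f x * siteIndicator k a x) g =
      pairing p f (fun x => siteIndicator k a x * g x) :=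
  Finset.sum_congr rfl fun x _ => by ring

theorem Sketch.siteMoment_eq_pairing (sk : Sketch n d) (p : Config n d → ℝ) (k : Fin n)
    (β : Fin (sk.m k.castSucc)) (a : Fin d) (γ : Fin (sk.l k.succ)) :
    sk.siteMoment p k (β, a) γ =
      pairing p (sk.S k.castSucc · β) (fun x => siteIndicator k a x * sk.T k.succ x γ) :=
  Finset.sum_congr rfl fun x _ => by
    simp only [siteIndicator]
    split_ifs <;> ring

theorem Sketch.siteMoment_mulVec (sk : Sketch n d) (p : Config n d → ℝ) (k : Fin n)
    (w : Fin (sk.l k.succ) → ℝ) :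
    sk.siteMoment p k *ᵥ w = fun βa => pairing p (sk.S k.castSucc · βa.1)
      (fun x => siteIndicator k βa.2 x * (sk.T k.succ x ⬝ᵥ w)) := by
  ext ⟨β, a⟩
  have hsmul : ∀ x, siteIndicator k a x * (sk.T k.succ x ⬝ᵥ w) =
      (fun γ => siteIndicator k a x * sk.T k.succ x γ) ⬝ᵥ w := fun x => by
    simp only [dotProduct, Finset.mul_sum, mul_assoc]
  simp only [hsmul, pairing_dotProduct, ← sk.siteMoment_eq_pairing]
  rfl

/-- The right sketch functions, combined along the `R_k` leading right singular vectors of the bond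
matrix, are functions on which the form is nondegenerate. -/
theorem exists_pairing_eq_sketch {sk : Sketch n d} {p : Config n d → ℝ} {k : Fin (n + 1)} {c : ℝ}
    (hc : 0 < c) (hsv : c ≤ singVal (sk.bondMoment p k) (unfoldingRank p k - 1))
    {g : Config n d → ℝ} (hg : DependsOn g (rightSites k)) :
    ∃ w : Fin (sk.l k) → ℝ, (∀ f, DependsOn f (leftSites k) →
        pairing p f g = pairing p f (fun x => sk.T k x ⬝ᵥ w)) ∧
      c * ‖w‖₂ ≤ ‖fun β => pairing p (sk.S k · β) g‖₂ := by
  obtain ⟨Y, hY, hWY⟩ := exists_isometry_of_le_singVal hc hsv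
  have hT : DependsOn (fun x => Yᵀ *ᵥ sk.T k x) (rightSites k) := fun x y h => by
    simp only [sk.T_dependsOn k h]
  have hTY : ∀ u, (fun x => (Yᵀ *ᵥ sk.T k x) ⬝ᵥ u) = fun x => sk.T k x ⬝ᵥ (Y *ᵥ u) := fun u => by
    simp only [Matrix.dotProduct_mulVec, Matrix.mulVec_transpose]
  have hS : ∀ β, DependsOn (sk.S k · β) (leftSites k) := dependsOn_apply (sk.S_dependsOn k)
  have hlower : BoundedBelow (sk.bondMoment p k * Y) c := fun u => by
    simpa only [← Matrix.mulVec_mulVec] using hWY u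
  obtain ⟨u, hu⟩ := exists_pairing_eq_dotProduct rfl hT (fun u hu => by
    refine hlower.eq_zero_of_mulVec_eq_zero hc ?_
    rw [← Matrix.mulVec_mulVec, sk.bondMoment_mulVec, ← hTY]
    exact funext fun β => hu _ (hS β)) hg
  simp only [hTY] at hu
  refine ⟨Y *ᵥ u, hu, ?_⟩
  have hsketch : (fun β => pairing p (sk.S k · β) g) = sk.bondMoment p k *ᵥ (Y *ᵥ u) := by
    rw [sk.bondMoment_mulVec]
    exact funext fun β => hu _ (hS β)
  rw [hsketch, hY]
  exact hWY u

end SketchMoments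

/-- Dual families `D` of functions of the right sites and `E` of functions of the left sites,
bounded by `K`, through which the bilinear form of `p` factors at the bond `k`. -/
structure IsBondFrame {n d : ℕ} (p : Config n d → ℝ) (k : Fin (n + 1)) {R : ℕ}
    (D E : Config n d → Fin R → ℝ) (K : ℝ) : Prop where
  right_dependsOn : DependsOn D (rightSites k)
  left_dependsOn : DependsOn E (leftSites k)
  right_le : ∀ x α, |D x α| ≤ K
  left_le : ∀ x α, |E x α| ≤ K
  pairing_eq : ∀ f g, DependsOn f (leftSites k) → DependsOn g (rightSites k) →
    pairing p f g = ∑ α, pairing p f (D · α) * pairing p (E · α) g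
  dual : ∀ α α', pairing p (E · α) (D · α') = if α = α' then 1 else 0

theorem IsBondFrame.mono {n d : ℕ} {p : Config n d → ℝ} {k : Fin (n + 1)} {R : ℕ}
    {D E : Config n d → Fin R → ℝ} {K K' : ℝ} (h : IsBondFrame p k D E K) (hK : K ≤ K') :
    IsBondFrame p k D E K' :=
  { h with
    right_le := fun x α => (h.right_le x α).trans hK
    left_le := fun x α => (h.left_le x α).trans hK }

theorem isBondFrame_of_eq_one {n d : ℕ} {p : Config n d → ℝ} (hp1 : ∑ x, p x = 1)
    {k : Fin (n + 1)} (hk : k = 0 ∨ k = Fin.last n) {R : ℕ} (hR : R = 1)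
    {D : Config n d → Fin R → ℝ} (hD : ∀ x α, D x α = 1) :
    IsBondFrame p k D (fun _ _ => 1) 1 where
  right_dependsOn := fun _ _ _ => by ext; simp only [hD]
  left_dependsOn := fun _ _ _ => rfl
  right_le := by simp [hD]
  left_le := by simp
  pairing_eq := fun f g hf hg => by
    subst hR
    rcases isEmpty_or_nonempty (Config n d) with hempty | ⟨⟨x₀⟩⟩
    · simp [pairing]
    rcases hk with rfl | rfl
    · have hconst : ∀ x, f x = f x₀ := fun x => hf fun i hi => absurd hi (Fin.not_lt_zero _)
      simp [pairing, hD, hconst, ← Finset.mul_sum, hp1, mul_assoc]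
    · have hconst : ∀ x, g x = g x₀ := fun x => hg fun i hi => absurd (Fin.castSucc_lt_last i) hi
      simp [pairing, hD, hconst, ← Finset.sum_mul, hp1]
  dual := fun α α' => by
    subst hR
    simp [pairing, hD, hp1, Subsingleton.elim α α']

/-! ### Stability of the gauges -/

/-- `p` is a probability density on a nonempty set of configurations, and the sketches, at most `ℓ`
in number on either side of every bond and bounded by `M`, preserve its ranks with constant `c`. -/
structure Sketch.IsAdapted {n d : ℕ} (sk : Sketch n d) (p : Config n d → ℝ) (ℓ : ℕ) (M c : ℝ) :
    Prop where
  dim_pos : 0 < d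
  nonneg : ∀ x, 0 ≤ p x
  sum_eq_one : ∑ x, p x = 1
  bounded : sk.BoundedBy ℓ M
  pos : 0 < c
  preservesRank : sk.PreservesRank p c

/-- Functions `f` of the left sites bounded by `M` satisfy
`|pairing p f g| ≤ sketchConst ℓ M c * t`, where `t` is the norm of the left sketch of `g`. -/
def sketchConst (ℓ : ℕ) (M c : ℝ) : ℝ := M * (ℓ * M) / c + M

/-- The factor by which the sketched tensor at a site can shrink vectors less than the one at the
bond on its right. -/
def siteConst (d ℓ : ℕ) (M c : ℝ) : ℝ := ℓ * (d * sketchConst ℓ M c)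

/-- A bound for the operator norm of sketched site tensors. -/
def opConst (d ℓ : ℕ) (M : ℝ) : ℝ := ℓ * d * (ℓ * (M * M))

/-- A lower bound for the singular values kept in the truncation of perturbed site tensors. -/
def gapConst (d ℓ : ℕ) (M c : ℝ) : ℝ := c / (2 * siteConst d ℓ M c)

/-- A lower bound for the exact bond matrices in the gauge of perturbed site tensors. -/
def bondConst (d ℓ : ℕ) (M c : ℝ) : ℝ := c / (2 * opConst d ℓ M)

namespace Sketch.IsAdapted

variable {n d ℓ : ℕ} {sk : Sketch n d} {p : Config n d → ℝ} {M c : ℝ}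
  (h : sk.IsAdapted p ℓ M c)
include h

theorem ne_zero : p ≠ 0 := by
  rintro rfl
  simpa using h.sum_eq_one

theorem one_le_card : 1 ≤ ℓ := sk.m_zero ▸ (h.bounded.1 0).1

theorem one_le_bound : 1 ≤ M := by
  have hS := h.bounded.2.1 0 (fun _ => ⟨0, h.dim_pos⟩) (Fin.cast sk.m_zero.symm 0)
  rwa [sk.S_zero, abs_one] at hS

theorem bound_pos : 0 < M := one_pos.trans_le h.one_le_bound

theorem card_pos : (0 : ℝ) < ℓ := by exact_mod_cast h.one_le_card

theorem card_left (k : Fin (n + 1)) : (sk.m k : ℝ) ≤ ℓ := by exact_mod_cast (h.bounded.1 k).1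

theorem card_right (k : Fin (n + 1)) : (sk.l k : ℝ) ≤ ℓ := by exact_mod_cast (h.bounded.1 k).2

theorem sketchConst_pos : 0 < sketchConst ℓ M c := by
  have := h.bound_pos
  have := h.pos
  unfold sketchConst
  positivity

theorem siteConst_pos : 0 < siteConst d ℓ M c :=
  mul_pos h.card_pos (mul_pos (Nat.cast_pos.2 h.dim_pos) h.sketchConst_pos)

theorem opConst_pos : 0 < opConst d ℓ M :=
  mul_pos (mul_pos h.card_pos (Nat.cast_pos.2 h.dim_pos))
    (mul_pos h.card_pos (mul_pos h.bound_pos h.bound_pos))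

theorem gapConst_pos : 0 < gapConst d ℓ M c :=
  div_pos h.pos (mul_pos two_pos h.siteConst_pos)

theorem bondConst_pos : 0 < bondConst d ℓ M c :=
  div_pos h.pos (mul_pos two_pos h.opConst_pos)

theorem abs_pairing_dotProduct_le (k : Fin (n + 1)) {f : Config n d → ℝ} (hf : ∀ x, |f x| ≤ M)
    (w : Fin (sk.l k) → ℝ) :
    |pairing p f (fun x => sk.T k x ⬝ᵥ w)| ≤ M * (ℓ * (M * ‖w‖₂)) := by
  refine abs_pairing_le h.nonneg h.sum_eq_one hf (fun x => ?_) h.bound_pos.le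
  calc |sk.T k x ⬝ᵥ w| ≤ sk.l k * (M * ‖w‖₂) := by
        simpa using abs_dotProduct_le (h.bounded.2.2 k x) (abs_apply_le_norm_toLp w)
    _ ≤ ℓ * (M * ‖w‖₂) := mul_le_mul_of_nonneg_right (h.card_right k)
        (mul_nonneg h.bound_pos.le (norm_nonneg _))

theorem abs_pairing_le_of_eq_zero {k : Fin (n + 1)} (hk : k = 0) {f : Config n d → ℝ}
    (hf : DependsOn f (leftSites k)) (hfM : ∀ x, |f x| ≤ M) (g : Config n d → ℝ) :
    |pairing p f g| ≤ M * ‖fun β => pairing p (sk.S k · β) g‖₂ := by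
  subst hk
  let x₀ : Config n d := fun _ => ⟨0, h.dim_pos⟩
  let β₀ : Fin (sk.m 0) := Fin.cast sk.m_zero.symm 0
  have hconst : f = fun x => f x₀ * sk.S 0 x β₀ := funext fun x => by
    rw [sk.S_zero, mul_one]
    exact hf fun i hi => absurd hi (Fin.not_lt_zero _)
  rw [hconst, pairing_const_mul_left, abs_mul]
  exact mul_le_mul (hfM x₀) (abs_apply_le_norm_toLp (fun β => pairing p (sk.S 0 · β) g) β₀)
    (abs_nonneg _) h.bound_pos.le

theorem abs_pairing_le_sketchConst_mul {k : Fin (n + 1)} (hk : k ≠ Fin.last n)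
    {f : Config n d → ℝ} (hf : DependsOn f (leftSites k)) (hfM : ∀ x, |f x| ≤ M)
    {g : Config n d → ℝ} (hg : DependsOn g (rightSites k)) :
    |pairing p f g| ≤ sketchConst ℓ M c * ‖fun β => pairing p (sk.S k · β) g‖₂ := by
  have hM := h.bound_pos
  have hc := h.pos
  rw [sketchConst, add_mul]
  by_cases hk0 : k = 0
  · refine (h.abs_pairing_le_of_eq_zero hk0 hf hfM g).trans (le_add_of_nonneg_left ?_)
    positivity
  · obtain ⟨w, hw, hcw⟩ := exists_pairing_eq_sketch hc (h.preservesRank k hk0 hk) hg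
    refine le_add_of_le_of_nonneg ?_ (by positivity)
    calc |pairing p f g| ≤ M * (ℓ * (M * ‖w‖₂)) := by
          rw [hw f hf]
          exact h.abs_pairing_dotProduct_le k hfM w
      _ = M * (ℓ * M) / c * (c * ‖w‖₂) := by field_simp
      _ ≤ _ := mul_le_mul_of_nonneg_left hcw (by positivity)

end Sketch.IsAdapted

section SiteMoments

variable {n d : ℕ} (sk : Sketch n d) (p : Config n d → ℝ) (k : Fin n)

theorem Sketch.bondMoment_mulVec_eq_sum (v : Fin (sk.l k.succ) → ℝ) (β : Fin (sk.m k.succ)) :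
    (sk.bondMoment p k.succ *ᵥ v) β = ∑ a, pairing p
      (fun x => sk.S k.succ (Function.update x k a) β)
      (fun x => siteIndicator k a x * (sk.T k.succ x ⬝ᵥ v)) := by
  simp only [sk.bondMoment_mulVec, pairing]
  rw [Finset.sum_comm]
  refine Finset.sum_congr rfl fun x _ => ?_
  rw [Finset.sum_eq_single (x k) (fun a _ ha => by simp [siteIndicator, ha.symm]) (by simp)]
  simp [siteIndicator]

theorem Sketch.dependsOn_S_update (a : Fin d) (β : Fin (sk.m k.succ)) :
    DependsOn (fun x => sk.S k.succ (Function.update x k a) β) (leftSites k.castSucc) := by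
  refine fun x y hxy => congrFun (sk.S_dependsOn _ fun i hi => ?_) β
  rcases eq_or_ne i k with rfl | hik
  · simp
  · rw [Function.update_of_ne hik, Function.update_of_ne hik]
    exact hxy i (Fin.castSucc_lt_castSucc_iff.2 (lt_of_le_of_ne
      (Fin.castSucc_lt_succ_iff.1 hi) hik))

theorem Sketch.norm_pairing_siteIndicator_le (v : Fin (sk.l k.succ) → ℝ) (a : Fin d) :
    ‖fun β => pairing p (sk.S k.castSucc · β)
      (fun x => siteIndicator k a x * (sk.T k.succ x ⬝ᵥ v))‖₂ ≤ ‖sk.siteMoment p k *ᵥ v‖₂ := by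
  refine le_of_sq_le_sq ?_ (norm_nonneg _)
  rw [sk.siteMoment_mulVec, norm_toLp_sq_eq_sum, norm_toLp_sq_eq_sum, Fintype.sum_prod_type]
  exact Finset.sum_le_sum fun β _ => Finset.single_le_sum
    (f := fun a => (pairing p (sk.S k.castSucc · β)
      (fun x => siteIndicator k a x * (sk.T k.succ x ⬝ᵥ v))) ^ 2)
    (fun a _ => sq_nonneg _) (Finset.mem_univ a)

end SiteMoments

namespace Sketch.IsAdapted

variable {n d ℓ : ℕ} {sk : Sketch n d} {p : Config n d → ℝ} {M c : ℝ}
  (h : sk.IsAdapted p ℓ M c) (k : Fin n)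
include h

theorem norm_bondMoment_mulVec_le (v : Fin (sk.l k.succ) → ℝ) :
    ‖sk.bondMoment p k.succ *ᵥ v‖₂ ≤ siteConst d ℓ M c * ‖sk.siteMoment p k *ᵥ v‖₂ := by
  have hK := h.sketchConst_pos.le
  have hterm : ∀ β a, |pairing p (fun x => sk.S k.succ (Function.update x k a) β)
      (fun x => siteIndicator k a x * (sk.T k.succ x ⬝ᵥ v))| ≤
        sketchConst ℓ M c * ‖sk.siteMoment p k *ᵥ v‖₂ := fun β a =>
    (h.abs_pairing_le_sketchConst_mul (Fin.castSucc_lt_last k).ne (sk.dependsOn_S_update k a β)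
      (fun x => h.bounded.2.1 _ _ _) (dependsOn_siteIndicator_mul
        (dependsOn_dotProduct (sk.T_dependsOn _) v))).trans
      (mul_le_mul_of_nonneg_left (sk.norm_pairing_siteIndicator_le p k v a) hK)
  have hentry : ∀ β, |(sk.bondMoment p k.succ *ᵥ v) β| ≤
      d * (sketchConst ℓ M c * ‖sk.siteMoment p k *ᵥ v‖₂) := fun β => by
    rw [sk.bondMoment_mulVec_eq_sum]
    refine (Finset.abs_sum_le_sum_abs _ _).trans ((Finset.sum_le_sum fun a _ => hterm β a).trans ?_)
    simp
  calc ‖sk.bondMoment p k.succ *ᵥ v‖₂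
      ≤ sk.m k.succ * (d * (sketchConst ℓ M c * ‖sk.siteMoment p k *ᵥ v‖₂)) := by
        simpa using norm_toLp_le_card_mul hentry
    _ ≤ ℓ * (d * (sketchConst ℓ M c * ‖sk.siteMoment p k *ᵥ v‖₂)) :=
        mul_le_mul_of_nonneg_right (h.card_left _) (by positivity)
    _ = siteConst d ℓ M c * ‖sk.siteMoment p k *ᵥ v‖₂ := by rw [siteConst]; ring

theorem norm_mulVec_le_of_abs_apply_le
    {E : Matrix (Fin (sk.m k.castSucc) × Fin d) (Fin (sk.l k.succ)) ℝ} {e : ℝ} (he : 0 ≤ e)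
    (hE : ∀ i j, |E i j| ≤ e) (v : Fin (sk.l k.succ) → ℝ) :
    ‖E *ᵥ v‖₂ ≤ ℓ * d * (ℓ * e) * ‖v‖₂ :=
  calc ‖E *ᵥ v‖₂ ≤ sk.m k.castSucc * d * (sk.l k.succ * (e * ‖v‖₂)) := by
        simpa using norm_mulVec_le hE v
    _ ≤ ℓ * d * (ℓ * (e * ‖v‖₂)) := by
        have := h.card_left k.castSucc
        have := h.card_right k.succ
        gcongr ?_ * _ * (?_ * _)
    _ = ℓ * d * (ℓ * e) * ‖v‖₂ := by ring

theorem abs_siteMoment_le (i : Fin (sk.m k.castSucc) × Fin d) (j : Fin (sk.l k.succ)) :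
    |sk.siteMoment p k i j| ≤ M * M := by
  rw [sk.siteMoment_eq_pairing]
  exact abs_pairing_le h.nonneg h.sum_eq_one (fun x => h.bounded.2.1 _ _ _)
    (fun x => (abs_siteIndicator_mul_le k _ x _).trans (h.bounded.2.2 _ _ _)) h.bound_pos.le

theorem mul_norm_siteMoment_mulVec_le (hk : k.succ ≠ Fin.last n) (v : Fin (sk.l k.succ) → ℝ) :
    c * ‖sk.siteMoment p k *ᵥ v‖₂ ≤ opConst d ℓ M * ‖sk.bondMoment p k.succ *ᵥ v‖₂ := by
  obtain ⟨w, hw, hcw⟩ := exists_pairing_eq_sketch h.pos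
    (h.preservesRank _ (Fin.succ_ne_zero k) hk) (dependsOn_dotProduct (sk.T_dependsOn _) v)
  rw [← sk.bondMoment_mulVec] at hcw
  have hvw : sk.siteMoment p k *ᵥ v = sk.siteMoment p k *ᵥ w := by
    simp only [sk.siteMoment_mulVec, ← pairing_mul_siteIndicator]
    exact funext fun βa => hw _ (dependsOn_mul_siteIndicator
      (dependsOn_apply (sk.S_dependsOn k.castSucc) βa.1))
  calc c * ‖sk.siteMoment p k *ᵥ v‖₂ ≤ c * (opConst d ℓ M * ‖w‖₂) := by
        rw [hvw]
        exact mul_le_mul_of_nonneg_left (h.norm_mulVec_le_of_abs_apply_le k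
          (mul_self_nonneg M) (h.abs_siteMoment_le k) w) h.pos.le
    _ = opConst d ℓ M * (c * ‖w‖₂) := by ring
    _ ≤ _ := mul_le_mul_of_nonneg_left hcw h.opConst_pos.le

section Perturbation

variable {k} (hk : k.succ ≠ Fin.last n)
  {Z : Matrix (Fin (sk.m k.castSucc) × Fin d) (Fin (sk.l k.succ)) ℝ} {e : ℝ} (he : 0 ≤ e)
  (hZ : ∀ i j, |Z i j - sk.siteMoment p k i j| ≤ e)
  (hsmall : ℓ * d * (ℓ * e) ≤ gapConst d ℓ M c / 2)
include he hZ hsmall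

theorem norm_sub_siteMoment_mulVec_le (v : Fin (sk.l k.succ) → ℝ) :
    ‖(Z - sk.siteMoment p k) *ᵥ v‖₂ ≤ gapConst d ℓ M c / 2 * ‖v‖₂ :=
  (h.norm_mulVec_le_of_abs_apply_le k he hZ v).trans
    (mul_le_mul_of_nonneg_right hsmall (norm_nonneg _))

include hk

theorem gapConst_le_singVal : gapConst d ℓ M c ≤ singVal Z (unfoldingRank p k.succ - 1) := by
  obtain ⟨Y, hY, hWY⟩ := exists_isometry_of_le_singVal h.pos
    (h.preservesRank _ (Fin.succ_ne_zero k) hk)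
  have hgap := h.gapConst_pos
  have hexact : BoundedBelow (sk.siteMoment p k * Y) (2 * gapConst d ℓ M c) := fun u => by
    have hsite := (hWY u).trans (h.norm_bondMoment_mulVec_le k (Y *ᵥ u))
    have hpos := h.siteConst_pos
    rw [← Matrix.mulVec_mulVec]
    calc 2 * gapConst d ℓ M c * ‖u‖₂ = c * ‖u‖₂ / siteConst d ℓ M c := by
          rw [gapConst]
          field_simp
      _ ≤ _ := (div_le_iff₀' hpos).2 hsite
  have hperturbed : BoundedBelow (Z * Y) (gapConst d ℓ M c) := by
    refine (hexact.of_norm_sub_mulVec_le (s := gapConst d ℓ M c / 2) fun u => ?_).mono (by linarith)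
    rw [← Matrix.sub_mul, ← Matrix.mulVec_mulVec, ← hY u]
    exact h.norm_sub_siteMoment_mulVec_le he hZ hsmall _
  exact le_singVal_of_isometry (unfoldingRank_pos h.ne_zero _) hY fun u => by
    simpa only [Matrix.mulVec_mulVec] using hperturbed u

variable {R : ℕ} (hR : R = unfoldingRank p k.succ)
  {q : Matrix (Fin (sk.l k.succ)) (Fin R) ℝ} (hq : IsTruncatedGauge Z q)
include hR hq

theorem abs_gauge_apply_le (γ : Fin (sk.l k.succ)) (α : Fin R) :
    |q γ α| ≤ 1 / gapConst d ℓ M c :=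
  hq.abs_apply_le h.gapConst_pos (hR ▸ h.gapConst_le_singVal hk he hZ hsmall) γ α

theorem boundedBelow_bondMoment_mul_gauge :
    BoundedBelow (sk.bondMoment p k.succ * q) (bondConst d ℓ M c) := fun u => by
  have hop := h.opConst_pos
  have hhalf := hq.half_norm_le h.gapConst_pos (hR ▸ h.gapConst_le_singVal hk he hZ hsmall)
    (h.norm_sub_siteMoment_mulVec_le he hZ hsmall) u
  have hbond := h.mul_norm_siteMoment_mulVec_le k hk (q *ᵥ u)
  rw [← Matrix.mulVec_mulVec]
  calc bondConst d ℓ M c * ‖u‖₂ = c * (1 / 2 * ‖u‖₂) / opConst d ℓ M := by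
        rw [bondConst]
        field_simp
    _ ≤ _ := (div_le_iff₀' hop).2 ((mul_le_mul_of_nonneg_left hhalf h.pos.le).trans hbond)

end Perturbation

end Sketch.IsAdapted

/-- The right sketch functions in the gauge `q`. -/
def gaugedSketch {n d R : ℕ} (sk : Sketch n d) {k : Fin (n + 1)}
    (q : Matrix (Fin (sk.l k)) (Fin R) ℝ) (x : Config n d) : Fin R → ℝ :=
  qᵀ *ᵥ sk.T k x

section Gauged

variable {n d R : ℕ} (sk : Sketch n d) (p : Config n d → ℝ)

theorem gaugedSketch_apply {k : Fin (n + 1)} (q : Matrix (Fin (sk.l k)) (Fin R) ℝ)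
    (x : Config n d) (α : Fin R) : gaugedSketch sk q x α = sk.T k x ⬝ᵥ fun γ => q γ α :=
  dotProduct_comm (fun γ => q γ α) (sk.T k x)

theorem pairing_gaugedSketch {k : Fin (n + 1)} (q : Matrix (Fin (sk.l k)) (Fin R) ℝ)
    (β : Fin (sk.m k)) (α : Fin R) :
    pairing p (sk.S k · β) (gaugedSketch sk q · α) = (sk.bondMoment p k * q) β α := by
  simp only [gaugedSketch_apply]
  exact (congrFun (sk.bondMoment_mulVec p k fun γ => q γ α) β).symm

theorem pairing_siteIndicator_mul_gaugedSketch {k : Fin n}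
    (q : Matrix (Fin (sk.l k.succ)) (Fin R) ℝ) (β : Fin (sk.m k.castSucc)) (a : Fin d)
    (α : Fin R) :
    pairing p (sk.S k.castSucc · β) (fun x => siteIndicator k a x * gaugedSketch sk q x α) =
      (sk.siteMoment p k * q) (β, a) α := by
  simp only [gaugedSketch_apply]
  exact (congrFun (sk.siteMoment_mulVec p k fun γ => q γ α) (β, a)).symm

theorem gaugedSketch_dependsOn {k : Fin (n + 1)} (q : Matrix (Fin (sk.l k)) (Fin R) ℝ) :
    DependsOn (gaugedSketch sk q) (rightSites k) := fun x y hxy => by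
  simp only [gaugedSketch, sk.T_dependsOn k hxy]

theorem gaugedSketch_last {q : Matrix (Fin (sk.l (Fin.last n))) (Fin R) ℝ}
    (hq : ∀ γ α, q γ α = 1) (x : Config n d) (α : Fin R) : gaugedSketch sk q x α = 1 := by
  simp [gaugedSketch_apply, dotProduct, hq, sk.T_last, sk.l_last]

end Gauged

/-- Where the gauged bond matrix is injective, a left inverse of it turns the left sketch functions
into functions dual to the gauged right sketch functions. -/
theorem Sketch.IsAdapted.exists_isBondFrame {n d ℓ : ℕ} {sk : Sketch n d} {p : Config n d → ℝ}
    {M c : ℝ} (h : sk.IsAdapted p ℓ M c) {k : Fin (n + 1)} {R : ℕ} (hR : R = unfoldingRank p k)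
    {q : Matrix (Fin (sk.l k)) (Fin R) ℝ} {κ τ : ℝ} (hτ : 0 < τ) (hκ : 0 ≤ κ)
    (hq : ∀ γ α, |q γ α| ≤ κ) (hW : BoundedBelow (sk.bondMoment p k * q) τ) :
    ∃ E, IsBondFrame p k (gaugedSketch sk q) E (ℓ * (κ * M) + ℓ * (1 / τ * M)) := by
  have hM := h.bound_pos
  obtain ⟨P, hPW, hP⟩ := hW.exists_leftInverse hτ
  have hD := gaugedSketch_dependsOn sk q
  have hE : DependsOn (fun x => P *ᵥ sk.S k x) (leftSites k) := fun x y hxy => by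
    simp only [sk.S_dependsOn k hxy]
  have hdual : ∀ α α', pairing p (fun x => (P *ᵥ sk.S k x) α) (gaugedSketch sk q · α') =
      if α = α' then 1 else 0 := fun α α' => by
    rw [← Matrix.one_apply, ← hPW]
    refine (dotProduct_pairing p (gaugedSketch sk q · α') (sk.S k) (P α)).trans ?_
    simp only [pairing_gaugedSketch]
    rfl
  refine ⟨fun x => P *ᵥ sk.S k x, hD, hE, fun x α => ?_, fun x α => ?_, fun f g hf hg => ?_, hdual⟩
  · refine le_add_of_le_of_nonneg ?_ (by positivity)
    calc |gaugedSketch sk q x α| ≤ sk.l k * (κ * M) :=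
          (abs_dotProduct_le (fun γ => hq γ α) (h.bounded.2.2 k x)).trans_eq
            (by rw [Fintype.card_fin])
      _ ≤ ℓ * (κ * M) := mul_le_mul_of_nonneg_right (h.card_right k) (by positivity)
  · refine le_add_of_nonneg_of_le (by positivity) ?_
    calc |(P *ᵥ sk.S k x) α| ≤ sk.m k * (1 / τ * M) :=
          (abs_dotProduct_le (hP α) (h.bounded.2.1 k x)).trans_eq (by rw [Fintype.card_fin])
      _ ≤ ℓ * (1 / τ * M) := mul_le_mul_of_nonneg_right (h.card_left k) (by positivity)
  · obtain ⟨u, hu⟩ := exists_pairing_eq_dotProduct hR.symm hD (fun u hu => by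
      refine hW.eq_zero_of_mulVec_eq_zero hτ (funext fun β => ?_)
      have hβ := hu (sk.S k · β) (dependsOn_apply (sk.S_dependsOn k) β)
      simp only [pairing_dotProduct, pairing_gaugedSketch] at hβ
      exact hβ) hg
    have hcoef : ∀ α, pairing p (fun x => (P *ᵥ sk.S k x) α) g = u α := fun α => by
      rw [hu _ (dependsOn_apply hE α), pairing_dotProduct]
      simp [hdual, dotProduct]
    rw [hu f hf, pairing_dotProduct]
    simp only [hcoef, dotProduct]

/-! ### Transfer matrices and sums over fibers -/

namespace MPS

variable {n d : ℕ} (θ : MPS n d)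

/-- The product of the cores to the left of the bond `k`. -/
def leftProd (k : Fin (n + 1)) : Config n d → Fin (θ.bond k) → ℝ :=
  Fin.induction (motive := fun k => Config n d → Fin (θ.bond k) → ℝ) (fun _ _ => 1)
    (fun k F x α' => ∑ α, F x α * θ.core k (x k) α α') k

theorem leftProd_zero (x : Config n d) (α : Fin (θ.bond 0)) : θ.leftProd 0 x α = 1 := rfl

theorem leftProd_succ (k : Fin n) (x : Config n d) (α' : Fin (θ.bond k.succ)) :
    θ.leftProd k.succ x α' = ∑ α, θ.leftProd k.castSucc x α * θ.core k (x k) α α' := by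
  simp only [leftProd, Fin.induction_succ]

theorem leftProd_dependsOn (k : Fin (n + 1)) : DependsOn (θ.leftProd k) (leftSites k) := by
  induction k using Fin.induction with
  | zero => exact fun x y _ => rfl
  | succ k ih =>
    intro x y h
    ext α'
    rw [leftProd_succ, leftProd_succ, h k Fin.castSucc_lt_succ,
      ih fun i hi => h i (lt_trans hi Fin.castSucc_lt_succ)]

end MPS

/-- The transfer matrix method. The weight `g` of the endpoint lets the induction absorb the last
step of the paths. -/
theorem sum_prod_path_eq {K : Type*} [CommSemiring K] {n : ℕ} (ι : Fin (n + 1) → Type*)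
    [∀ k, Fintype (ι k)] (w : (k : Fin n) → ι k.castSucc → ι k.succ → K)
    (F : (k : Fin (n + 1)) → ι k → K) (hF0 : ∀ a, F 0 a = 1)
    (hF : ∀ k b, F k.succ b = ∑ a, F k.castSucc a * w k a b) (g : ι (Fin.last n) → K) :
    ∑ α : (k : Fin (n + 1)) → ι k, (∏ k, w k (α k.castSucc) (α k.succ)) * g (α (Fin.last n)) =
      ∑ a, F (Fin.last n) a * g a := by
  induction n with
  | zero =>
    rw [← (Fin.snocEquiv ι).sum_comp, Fintype.sum_prod_type]
    refine Finset.sum_congr rfl fun a _ => ?_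
    have hFa : F (Fin.last 0) a = 1 := hF0 a
    simp only [hFa, Finset.univ_eq_empty, Finset.prod_empty, one_mul, Fin.snocEquiv,
      Equiv.coe_fn_mk]
    rw [Finset.univ_unique, Finset.sum_singleton]
    exact congrArg g (Fin.snoc_last (α := ι) _ _)
  | succ n ih =>
    rw [← (Fin.snocEquiv ι).sum_comp, Fintype.sum_prod_type]
    refine Finset.sum_congr rfl fun b _ => ?_
    have hlast : F (Fin.last (n + 1)) b * g b = ∑ a, F (Fin.last n).castSucc a *
        (w (Fin.last n) a b * g b) := by
      have hFb : F (Fin.last (n + 1)) b = ∑ a, F (Fin.last n).castSucc a * w (Fin.last n) a b :=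
        hF (Fin.last n) b
      simp only [hFb, Finset.sum_mul, mul_assoc]
    refine Eq.trans ?_ ((ih (fun k => ι k.castSucc) (fun k => w k.castSucc)
      (fun k => F k.castSucc) hF0 (fun k b => hF k.castSucc b)
      (fun a => w (Fin.last n) a b * g b)).trans hlast.symm)
    refine Finset.sum_congr rfl fun α _ => ?_
    rw [Fin.prod_univ_castSucc]
    simp only [Fin.snocEquiv, Equiv.coe_fn_mk, Fin.snoc_castSucc, ← Fin.castSucc_succ,
      Fin.succ_last, Fin.snoc_last, mul_assoc]

theorem MPS.eval_eq_sum_leftProd {n d : ℕ} (θ : MPS n d) (x : Config n d) :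
    θ.eval x = ∑ α, θ.leftProd (Fin.last n) x α := by
  simpa [MPS.eval] using sum_prod_path_eq (fun k => Fin (θ.bond k)) (fun k => θ.core k (x k))
    (fun k => θ.leftProd k x) (fun _ => rfl) (fun k b => θ.leftProd_succ k x b) (fun _ => 1)

section Agree

variable {n d : ℕ}

open Classical in
/-- The indicator function of agreement of two configurations on a set of sites. -/
def agree (s : Set (Fin n)) (x y : Config n d) : ℝ := if ∀ i ∈ s, x i = y i then 1 else 0

theorem agree_comm (s : Set (Fin n)) (x y : Config n d) : agree s x y = agree s y x := by
  have hiff : (∀ i ∈ s, x i = y i) ↔ ∀ i ∈ s, y i = x i := forall₂_congr fun i _ => eq_comm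
  classical exact if_congr hiff rfl rfl

theorem agree_nonneg (s : Set (Fin n)) (x y : Config n d) : 0 ≤ agree s x y := by
  unfold agree
  split_ifs <;> simp

theorem agree_mul_congr {s : Set (Fin n)} {f : Config n d → ℝ} (hf : DependsOn f s)
    (x y : Config n d) : agree s x y * f x = agree s x y * f y := by
  unfold agree
  split_ifs with h
  · rw [hf h]
  · simp

theorem agree_dependsOn (s : Set (Fin n)) (x : Config n d) : DependsOn (agree s · x) s :=
  fun y z h => by
    have hiff : (∀ i ∈ s, y i = x i) ↔ ∀ i ∈ s, z i = x i :=
      forall₂_congr fun i hi => by rw [h i hi]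
    classical exact if_congr hiff rfl rfl

theorem sum_agree_mul_agree (k : Fin (n + 1)) (x z : Config n d) :
    ∑ y, agree (leftSites k) y x * agree (rightSites k) y z = 1 := by
  classical
  have hx : ∀ i ∈ leftSites k, (if i.castSucc < k then x i else z i) = x i := fun i hi => if_pos hi
  have hz : ∀ i ∈ rightSites k, (if i.castSucc < k then x i else z i) = z i :=
    fun i hi => if_neg hi
  rw [Finset.sum_eq_single (fun i => if i.castSucc < k then x i else z i)]
  · rw [agree, agree, if_pos hx, if_pos hz, one_mul]
  · intro y _ hy
    unfold agree
    split_ifs with hx hz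
    · refine absurd (funext fun i => ?_) hy
      split_ifs with hi
      exacts [hx i hi, hz i hi]
    all_goals simp
  · simp

theorem agree_rightSites_update (k : Fin n) (a : Fin d) (y z : Config n d) :
    agree (rightSites k.castSucc) y (Function.update z k a) =
      siteIndicator k a y * agree (rightSites k.succ) y z := by
  have hiff : (∀ i ∈ rightSites k.castSucc, y i = Function.update z k a i) ↔
      y k = a ∧ ∀ i ∈ rightSites k.succ, y i = z i := by
    constructor
    · intro h
      refine ⟨by simpa using h k (lt_irrefl _), fun i hi => ?_⟩
      have hik : i ≠ k := fun hik => hi (hik ▸ Fin.castSucc_lt_succ)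
      rw [h i fun hlt => hi (lt_trans hlt Fin.castSucc_lt_succ), Function.update_of_ne hik]
    · rintro ⟨hk, hsucc⟩ i hi
      rcases eq_or_ne i k with rfl | hik
      · simpa using hk
      · rw [Function.update_of_ne hik]
        exact hsucc i fun hlt => hi (Fin.castSucc_lt_castSucc_iff.2
          (lt_of_le_of_ne (Fin.castSucc_lt_succ_iff.1 hlt) hik))
  simp only [agree, siteIndicator, hiff]
  split_ifs <;> simp_all

theorem sum_agree_mul_agree_succ (k : Fin n) (y z : Config n d) :
    ∑ x, agree (leftSites k.castSucc) x y * agree (rightSites k.succ) x z = d := by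
  have hsplit : ∀ x : Config n d, agree (rightSites k.succ) x z =
      ∑ a, agree (rightSites k.castSucc) x (Function.update z k a) := fun x => by
    simp [agree_rightSites_update, siteIndicator]
  simp only [hsplit, Finset.mul_sum]
  rw [Finset.sum_comm]
  simp [sum_agree_mul_agree]

/-- The sum of `f` over the configurations that agree with `x` on `s`. -/
def fiberSum (s : Set (Fin n)) (f : Config n d → ℝ) (x : Config n d) : ℝ :=
  ∑ y, agree s y x * f y

theorem fiberSum_nonneg {f : Config n d → ℝ} (hf : ∀ x, 0 ≤ f x) (s : Set (Fin n))
    (x : Config n d) : 0 ≤ fiberSum s f x :=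
  Finset.sum_nonneg fun y _ => mul_nonneg (agree_nonneg s y x) (hf y)

theorem abs_fiberSum_le {f g : Config n d → ℝ} (h : ∀ x, |f x| ≤ g x) (s : Set (Fin n))
    (x : Config n d) : |fiberSum s f x| ≤ fiberSum s g x := by
  refine (Finset.abs_sum_le_sum_abs _ _).trans (Finset.sum_le_sum fun y _ => ?_)
  rw [abs_mul, abs_of_nonneg (agree_nonneg s y x)]
  exact mul_le_mul_of_nonneg_left (h y) (agree_nonneg s y x)

theorem fiberSum_const_mul (s : Set (Fin n)) (a : ℝ) (f : Config n d → ℝ) (x : Config n d) :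
    fiberSum s (fun y => a * f y) x = a * fiberSum s f x := by
  simp only [fiberSum, Finset.mul_sum, mul_left_comm]

theorem fiberSum_sum {ι : Type*} [Fintype ι] (s : Set (Fin n)) (f : ι → Config n d → ℝ)
    (x : Config n d) : fiberSum s (fun y => ∑ i, f i y) x = ∑ i, fiberSum s (f i) x := by
  simp only [fiberSum, Finset.mul_sum]
  exact Finset.sum_comm

theorem pairing_agree (p f : Config n d → ℝ) (s : Set (Fin n)) (x : Config n d) :
    pairing p f (agree s · x) = fiberSum s (fun y => f y * p y) x :=
  Finset.sum_congr rfl fun _ _ => mul_comm _ _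

theorem fiberSum_leftSites_mul_fiberSum (k : Fin (n + 1)) {f g : Config n d → ℝ}
    (hf : DependsOn f (leftSites k)) (hg : DependsOn g (rightSites k)) (w : Config n d → ℝ)
    (x : Config n d) :
    fiberSum (leftSites k) (fun y => f y * fiberSum (rightSites k) w y * g y) x =
      f x * ∑ z, w z * g z := by
  have hterm : ∀ y z, agree (leftSites k) y x * (f y * (agree (rightSites k) z y * w z) * g y) =
      f x * (w z * g z) * (agree (leftSites k) y x * agree (rightSites k) y z) := fun y z => by
    rw [agree_comm _ z y]
    linear_combination (agree (rightSites k) y z * w z * g y) * agree_mul_congr hf y x +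
      (agree (leftSites k) y x * f x * w z) * agree_mul_congr hg y z
  calc fiberSum (leftSites k) (fun y => f y * fiberSum (rightSites k) w y * g y) x
      = ∑ y, ∑ z, f x * (w z * g z) * (agree (leftSites k) y x * agree (rightSites k) y z) := by
        simp only [← hterm, fiberSum, Finset.mul_sum, Finset.sum_mul]
    _ = f x * ∑ z, w z * g z := by
        rw [Finset.sum_comm]
        simp only [← Finset.mul_sum, sum_agree_mul_agree, mul_one]

theorem sum_fiberSum_mul_fiberSum_succ (k : Fin n) (f g : Config n d → ℝ) :
    ∑ x, fiberSum (leftSites k.castSucc) f x * fiberSum (rightSites k.succ) g x =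
      d * ((∑ y, f y) * ∑ z, g z) := by
  have hterm : ∀ x y z, agree (leftSites k.castSucc) y x * f y *
      (agree (rightSites k.succ) z x * g z) = f y * g z *
        (agree (leftSites k.castSucc) x y * agree (rightSites k.succ) x z) := fun x y z => by
    rw [agree_comm _ y x, agree_comm _ z x]
    ring
  calc ∑ x, fiberSum (leftSites k.castSucc) f x * fiberSum (rightSites k.succ) g x
      = ∑ x, ∑ y, ∑ z, f y * g z *
          (agree (leftSites k.castSucc) x y * agree (rightSites k.succ) x z) := by
        simp only [fiberSum, Finset.sum_mul_sum, hterm]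
    _ = ∑ y, ∑ z, f y * g z * d := by
        rw [Finset.sum_comm]
        refine Finset.sum_congr rfl fun y _ => ?_
        rw [Finset.sum_comm]
        simp only [← Finset.mul_sum, sum_agree_mul_agree_succ]
    _ = d * ((∑ y, f y) * ∑ z, g z) := by
        rw [Finset.sum_mul_sum]
        simp only [Finset.mul_sum, mul_comm]

end Agree

/-! ### Exact cores and hybrid tensors -/

section ExactCores

variable {n d : ℕ} (p : Config n d → ℝ) {r : Fin (n + 1) → ℕ}
  (D E : (k : Fin (n + 1)) → Config n d → Fin (r k) → ℝ)

/-- The core at the site `k` of the matrix product state that represents `p` in the frames `D`,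
`E`. -/
def exactCore (k : Fin n) (a : Fin d) : Matrix (Fin (r k.castSucc)) (Fin (r k.succ)) ℝ :=
  Matrix.of fun α α' => pairing p (E k.castSucc · α) (fun x => siteIndicator k a x * D k.succ x α')

/-- The product of the exact cores to the right of the bond `k`. In closed form it is the sum of
`E_k p` over the configurations of the left sites. -/
def exactRight (k : Fin (n + 1)) (α : Fin (r k)) : Config n d → ℝ :=
  fiberSum (rightSites k) fun y => E k y α * p y

variable {p D E} {K : ℝ} (hF : ∀ k, IsBondFrame p k (D k) (E k) K)
include hF

theorem exactRight_castSucc (k : Fin n) (α : Fin (r k.castSucc)) (x : Config n d) :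
    exactRight p E k.castSucc α x =
      ∑ α', exactCore p D E k (x k) α α' * exactRight p E k.succ α' x := by
  have hagree : ∀ y, agree (rightSites k.castSucc) y x =
      siteIndicator k (x k) y * agree (rightSites k.succ) y x := fun y => by
    rw [← agree_rightSites_update, Function.update_eq_self]
  rw [exactRight, ← pairing_agree]
  simp only [hagree]
  rw [← pairing_mul_siteIndicator, (hF k.succ).pairing_eq _ _ (dependsOn_mul_siteIndicator
    (dependsOn_apply (hF k.castSucc).left_dependsOn α)) (agree_dependsOn _ _)]
  simp only [pairing_mul_siteIndicator, pairing_agree]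
  rfl

theorem abs_exactRight_le (hp : ∀ x, 0 ≤ p x) (k : Fin (n + 1)) (α : Fin (r k))
    (x : Config n d) : |exactRight p E k α x| ≤ K * fiberSum (rightSites k) p x := by
  rw [← fiberSum_const_mul]
  refine abs_fiberSum_le (fun y => ?_) _ x
  rw [abs_mul, abs_of_nonneg (hp y)]
  exact mul_le_mul_of_nonneg_right ((hF k).left_le y α) (hp y)

end ExactCores

section Hybrid

variable {n d : ℕ} (p : Config n d → ℝ) (ψ : MPS n d)
  {D : (k : Fin (n + 1)) → Config n d → Fin (ψ.bond k) → ℝ}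
  (E : (k : Fin (n + 1)) → Config n d → Fin (ψ.bond k) → ℝ)

/-- The tensor with the cores of `ψ` to the left of the bond `k` and exact cores to the right of
it. -/
def hybrid (k : Fin (n + 1)) (x : Config n d) : ℝ :=
  ∑ α, ψ.leftProd k x α * exactRight p E k α x

variable {p ψ E}

theorem hybrid_zero (hE : ∀ x α, E 0 x α = 1) : hybrid p ψ E 0 = p := by
  ext x
  have hright : ∀ α, exactRight p E 0 α x = p x := fun α => by
    rw [exactRight, fiberSum, Finset.sum_eq_single x]
    · simp [hE, agree]
    · intro y _ hy
      have hne : ¬ ∀ i ∈ rightSites (0 : Fin (n + 1)), y i = x i := fun h =>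
        hy (funext fun i => h i (Fin.not_lt_zero _))
      simp only [agree, if_neg hne, zero_mul]
    · simp
  simp [hybrid, MPS.leftProd_zero, hright, ψ.bond_zero]

theorem hybrid_last (hp1 : ∑ x, p x = 1) (hE : ∀ x α, E (Fin.last n) x α = 1) :
    hybrid p ψ E (Fin.last n) = ψ.eval := by
  ext x
  have hagree : ∀ y : Config n d, agree (rightSites (Fin.last n)) y x = 1 := fun y =>
    if_pos fun i hi => absurd (Fin.castSucc_lt_last i) hi
  simp [hybrid, exactRight, fiberSum, hE, hagree, hp1, MPS.eval_eq_sum_leftProd]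

variable {K : ℝ} (hF : ∀ k, IsBondFrame p k (D k) (E k) K)
include hF

theorem hybrid_succ_sub (k : Fin n) (x : Config n d) :
    hybrid p ψ E k.succ x - hybrid p ψ E k.castSucc x = ∑ α, ∑ α', ψ.leftProd k.castSucc x α *
      (ψ.core k (x k) α α' - exactCore p D E k (x k) α α') * exactRight p E k.succ α' x := by
  simp only [hybrid, ψ.leftProd_succ, exactRight_castSucc hF, mul_sub, sub_mul,
    Finset.sum_sub_distrib, Finset.mul_sum, Finset.sum_mul, mul_assoc]
  rw [Finset.sum_comm]

/-- The left products are recovered from the hybrid tensor by testing it against the functions `D`,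
which are dual to `E`. -/
theorem leftProd_eq_fiberSum_hybrid (k : Fin (n + 1)) (x : Config n d) (α : Fin (ψ.bond k)) :
    ψ.leftProd k x α = fiberSum (leftSites k) (fun y => hybrid p ψ E k y * D k y α) x := by
  simp only [hybrid, exactRight, Finset.sum_mul, fiberSum_sum]
  have hterm := fun α' => fiberSum_leftSites_mul_fiberSum k
    (dependsOn_apply (ψ.leftProd_dependsOn k) α') (dependsOn_apply (hF k).right_dependsOn α)
    (fun y => E k y α' * p y) x
  have hdual := (hF k).dual
  simp only [pairing] at hdual
  simp [hterm, hdual]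

theorem abs_leftProd_le (k : Fin (n + 1)) (x : Config n d) (α : Fin (ψ.bond k)) :
    |ψ.leftProd k x α| ≤ K * fiberSum (leftSites k) (fun y => |hybrid p ψ E k y|) x := by
  rw [leftProd_eq_fiberSum_hybrid hF, ← fiberSum_const_mul]
  refine abs_fiberSum_le (fun y => ?_) _ x
  rw [abs_mul, mul_comm]
  exact mul_le_mul_of_nonneg_right ((hF k).right_le y α) (abs_nonneg _)

variable (hp : ∀ x, 0 ≤ p x) (hK : 0 ≤ K) {ℓ : ℕ} (hℓ : ∀ k, ψ.bond k ≤ ℓ) {η : ℝ} (hη : 0 ≤ η)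
include hp hK hℓ hη

theorem abs_hybrid_succ_sub_le (k : Fin n)
    (hcore : ∀ a α α', |ψ.core k a α α' - exactCore p D E k a α α'| ≤ η) (x : Config n d) :
    |hybrid p ψ E k.succ x - hybrid p ψ E k.castSucc x| ≤ ℓ * ℓ * (K * K) * η *
      (fiberSum (leftSites k.castSucc) (fun y => |hybrid p ψ E k.castSucc y|) x *
        fiberSum (rightSites k.succ) p x) := by
  set a := fiberSum (leftSites k.castSucc) (fun y => |hybrid p ψ E k.castSucc y|) x
  set b := fiberSum (rightSites k.succ) p x
  have ha : 0 ≤ a := fiberSum_nonneg (fun y => abs_nonneg _) _ x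
  have hb : 0 ≤ b := fiberSum_nonneg hp _ x
  have hterm : ∀ α α', |ψ.leftProd k.castSucc x α *
      (ψ.core k (x k) α α' - exactCore p D E k (x k) α α') * exactRight p E k.succ α' x| ≤
        K * a * η * (K * b) := fun α α' => by
    rw [abs_mul, abs_mul]
    have hleft := abs_leftProd_le hF k.castSucc x α
    have hright := abs_exactRight_le hF hp k.succ α' x
    have hmid := hcore (x k) α α'
    gcongr
  have : ∀ k, (ψ.bond k : ℝ) ≤ ℓ := fun k => by exact_mod_cast hℓ k
  rw [hybrid_succ_sub hF]
  calc _ ≤ ∑ _α : Fin (ψ.bond k.castSucc), ∑ _α' : Fin (ψ.bond k.succ), K * a * η * (K * b) :=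
        (Finset.abs_sum_le_sum_abs _ _).trans (Finset.sum_le_sum fun α _ =>
          (Finset.abs_sum_le_sum_abs _ _).trans (Finset.sum_le_sum fun α' _ => hterm α α'))
    _ = ψ.bond k.castSucc * (ψ.bond k.succ * (K * a * η * (K * b))) := by simp
    _ ≤ ℓ * (ℓ * (K * a * η * (K * b))) := by
        gcongr
        exacts [hℓ _, hℓ _]
    _ = ℓ * ℓ * (K * K) * η * (a * b) := by ring

variable (hp1 : ∑ x, p x = 1)
include hp1

theorem sum_abs_hybrid_succ_sub_le (k : Fin n)
    (hcore : ∀ a α α', |ψ.core k a α α' - exactCore p D E k a α α'| ≤ η) :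
    ∑ x, |hybrid p ψ E k.succ x - hybrid p ψ E k.castSucc x| ≤
      d * (ℓ * ℓ) * (K * K) * η * ∑ x, |hybrid p ψ E k.castSucc x| := by
  refine (Finset.sum_le_sum fun x _ =>
    abs_hybrid_succ_sub_le hF hp hK hℓ hη k hcore x).trans_eq ?_
  rw [← Finset.mul_sum, sum_fiberSum_mul_fiberSum_succ, hp1]
  ring

variable (hcore : ∀ k a α α', |ψ.core k a α α' - exactCore p D E k a α α'| ≤ η)
  (hE0 : ∀ x α, E 0 x α = 1) (hsmall : 2 * n * (d * (ℓ * ℓ) * (K * K) * η) ≤ 1)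
include hcore hE0 hsmall

theorem sum_abs_hybrid_sub_le (k : Fin (n + 1)) :
    ∑ x, |hybrid p ψ E k x - p x| ≤ 2 * (k : ℕ) * (d * (ℓ * ℓ) * (K * K) * η) := by
  set τ : ℝ := d * (ℓ * ℓ) * (K * K) * η
  have hτ : 0 ≤ τ := by positivity
  induction k using Fin.induction with
  | zero => simp [hybrid_zero hE0]
  | succ k ih =>
    rw [Fin.val_castSucc] at ih
    have hkn : (k : ℝ) ≤ n := by exact_mod_cast k.2.le
    have hnorm : ∑ x, |hybrid p ψ E k.castSucc x| ≤ 2 :=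
      calc ∑ x, |hybrid p ψ E k.castSucc x|
          ≤ ∑ x, (|p x| + |hybrid p ψ E k.castSucc x - p x|) := Finset.sum_le_sum fun x _ => by
            simpa using abs_add_le (p x) (hybrid p ψ E k.castSucc x - p x)
        _ = 1 + ∑ x, |hybrid p ψ E k.castSucc x - p x| := by
            simp only [Finset.sum_add_distrib, abs_of_nonneg (hp _), hp1]
        _ ≤ 1 + 2 * n * τ := by gcongr; exact ih.trans (by gcongr)
        _ ≤ 2 := by linarith
    calc ∑ x, |hybrid p ψ E k.succ x - p x|
        ≤ ∑ x, |hybrid p ψ E k.succ x - hybrid p ψ E k.castSucc x| +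
            ∑ x, |hybrid p ψ E k.castSucc x - p x| := by
          rw [← Finset.sum_add_distrib]
          exact Finset.sum_le_sum fun x _ => abs_sub_le _ _ _
      _ ≤ τ * 2 + 2 * k * τ :=
          add_le_add ((sum_abs_hybrid_succ_sub_le hF hp hK hℓ hη hp1 k (hcore k)).trans
            (mul_le_mul_of_nonneg_left hnorm hτ)) ih
      _ = 2 * (k.succ : ℕ) * τ := by
          rw [Fin.val_succ, Nat.cast_add_one]
          ring

theorem sum_abs_eval_sub_le (hEn : ∀ x α, E (Fin.last n) x α = 1) :
    ∑ x, |ψ.eval x - p x| ≤ 2 * n * (d * (ℓ * ℓ) * (K * K) * η) := by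
  rw [← hybrid_last hp1 hEn]
  exact sum_abs_hybrid_sub_le hF hp hK hℓ hη hp1 hcore hE0 hsmall (Fin.last n)

end Hybrid

/-! ### Stability of the cores -/

/-- A bound for the entries of the gauges. -/
def gaugeConst (d ℓ : ℕ) (M c : ℝ) : ℝ := max (1 / gapConst d ℓ M c) 1

/-- A bound for the frames of the exact tensor. -/
def frameConst (d ℓ : ℕ) (M c : ℝ) : ℝ :=
  max (ℓ * (gaugeConst d ℓ M c * M) + ℓ * (1 / bondConst d ℓ M c * M)) 1

theorem gaugeConst_pos (d ℓ : ℕ) (M c : ℝ) : 0 < gaugeConst d ℓ M c :=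
  lt_max_of_lt_right one_pos

theorem frameConst_pos (d ℓ : ℕ) (M c : ℝ) : 0 < frameConst d ℓ M c :=
  lt_max_of_lt_right one_pos

/-- A lower bound for the exact system matrices, including the constant one at the left end. -/
def systemConst (d ℓ : ℕ) (M c : ℝ) : ℝ := min (bondConst d ℓ M c) 1

/-- The ratio of the error of the cores to that of the sketched tensors. -/
def coreConst (d ℓ : ℕ) (M c : ℝ) : ℝ :=
  2 / systemConst d ℓ M c * (ℓ * (ℓ * gaugeConst d ℓ M c +
    ℓ * (ℓ * gaugeConst d ℓ M c * (frameConst d ℓ M c * frameConst d ℓ M c))))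

/-- The accuracy of the sketched tensors, relative to `ε / n`, that the algorithm needs. The three
terms keep the truncation gap open, the least squares systems injective, and the error of the output
small. -/
def tolConst (d ℓ : ℕ) (M c : ℝ) : ℝ :=
  min (gapConst d ℓ M c / (2 * (ℓ * d * ℓ)))
    (min (systemConst d ℓ M c / (2 * (ℓ * (ℓ * (ℓ * gaugeConst d ℓ M c)))))
      (1 / (8 * (d * (ℓ * ℓ) * (frameConst d ℓ M c * frameConst d ℓ M c) * coreConst d ℓ M c))))

/-- The sketched tensors of `p'` and `p` differ by at most `e` in every entry. -/
def Sketch.IsClose {n d : ℕ} (sk : Sketch n d) (p p' : Config n d → ℝ) (e : ℝ) : Prop :=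
  (∀ k i j, |sk.bondMoment p' k i j - sk.bondMoment p k i j| ≤ e) ∧
    ∀ k i j, |sk.siteMoment p' k i j - sk.siteMoment p k i j| ≤ e

/-- The gauges `q` have entries at most `κ` at the right ends of the sites, are constant at the last
bond, and keep the sketched tensors of `p` at the interior bonds bounded below by `τ`. -/
structure Sketch.IsStableGauge {n d : ℕ} (sk : Sketch n d) (p : Config n d → ℝ)
    {r : Fin (n + 1) → ℕ} (q : (k : Fin (n + 1)) → Matrix (Fin (sk.l k)) (Fin (r k)) ℝ)
    (κ τ : ℝ) : Prop where
  last : ∀ γ α, q (Fin.last n) γ α = 1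
  abs_le : ∀ (k : Fin n) γ α, |q k.succ γ α| ≤ κ
  boundedBelow : ∀ k, k ≠ 0 → k ≠ Fin.last n → BoundedBelow (sk.bondMoment p k * q k) τ

/-- The gauged right sketch functions, with the constant `1` at the left end. -/
def rightFrame {n d : ℕ} (sk : Sketch n d) {r : Fin (n + 1) → ℕ}
    (q : (k : Fin (n + 1)) → Matrix (Fin (sk.l k)) (Fin (r k)) ℝ) (k : Fin (n + 1)) :
    Config n d → Fin (r k) → ℝ :=
  if k = 0 then fun _ _ => 1 else gaugedSketch sk (q k)

theorem rightFrame_succ {n d : ℕ} (sk : Sketch n d) {r : Fin (n + 1) → ℕ}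
    (q : (k : Fin (n + 1)) → Matrix (Fin (sk.l k)) (Fin (r k)) ℝ) (k : Fin n) :
    rightFrame sk q k.succ = gaugedSketch sk (q k.succ) :=
  if_neg (Fin.succ_ne_zero k)

theorem rightFrame_eq_one {n d : ℕ} {sk : Sketch n d} {r : Fin (n + 1) → ℕ}
    {q : (k : Fin (n + 1)) → Matrix (Fin (sk.l k)) (Fin (r k)) ℝ}
    (hq : ∀ γ α, q (Fin.last n) γ α = 1) {k : Fin (n + 1)} (hk : k = 0 ∨ k = Fin.last n)
    (x : Config n d) (α : Fin (r k)) : rightFrame sk q k x α = 1 := by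
  by_cases hk0 : k = 0
  · rw [rightFrame, if_pos hk0]
  · obtain rfl := hk.resolve_left hk0
    rw [rightFrame, if_neg hk0, gaugedSketch_last sk hq]

namespace Sketch.IsAdapted

variable {n d ℓ : ℕ} {sk : Sketch n d} {p : Config n d → ℝ} {M c : ℝ}
  (h : sk.IsAdapted p ℓ M c)
include h

theorem systemConst_pos : 0 < systemConst d ℓ M c := lt_min h.bondConst_pos one_pos

theorem coreConst_pos : 0 < coreConst d ℓ M c := by
  have := gaugeConst_pos d ℓ M c
  have := h.systemConst_pos
  have := frameConst_pos d ℓ M c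
  have := h.card_pos
  unfold coreConst
  positivity

theorem tolConst_pos : 0 < tolConst d ℓ M c := by
  have := h.gapConst_pos
  have := gaugeConst_pos d ℓ M c
  have := h.systemConst_pos
  have := frameConst_pos d ℓ M c
  have := h.coreConst_pos
  have := h.card_pos
  have : (0 : ℝ) < d := Nat.cast_pos.2 h.dim_pos
  unfold tolConst
  positivity

theorem tolConst_spec (hn : 1 ≤ n) {ε : ℝ} (hε : 0 < ε) (hε1 : ε ≤ 1) :
    let e := tolConst d ℓ M c * ε / n
    0 ≤ e ∧ ℓ * d * (ℓ * e) ≤ gapConst d ℓ M c / 2 ∧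
      ℓ * (ℓ * (ℓ * (e * gaugeConst d ℓ M c))) ≤ systemConst d ℓ M c / 2 ∧
      2 * n * (d * (ℓ * ℓ) * (frameConst d ℓ M c * frameConst d ℓ M c) *
        (coreConst d ℓ M c * e)) ≤ ε / 4 := by
  intro e
  have hκ := gaugeConst_pos d ℓ M c
  have hK := frameConst_pos d ℓ M c
  have hcore := h.coreConst_pos
  have hℓ := h.card_pos
  have hd : (0 : ℝ) < d := Nat.cast_pos.2 h.dim_pos
  have ht := h.tolConst_pos
  have hn1 : (1 : ℝ) ≤ n := by exact_mod_cast hn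
  have hn0 : (0 : ℝ) < n := one_pos.trans_le hn1
  have he : e ≤ tolConst d ℓ M c := by
    rw [div_le_iff₀ hn0]
    exact mul_le_mul_of_nonneg_left (hε1.trans hn1) ht.le
  obtain ⟨hgap, hsystem, hframe⟩ : tolConst d ℓ M c ≤ gapConst d ℓ M c / (2 * (ℓ * d * ℓ)) ∧
      tolConst d ℓ M c ≤ systemConst d ℓ M c / (2 * (ℓ * (ℓ * (ℓ * gaugeConst d ℓ M c)))) ∧
      tolConst d ℓ M c ≤ 1 / (8 * (d * (ℓ * ℓ) *
        (frameConst d ℓ M c * frameConst d ℓ M c) * coreConst d ℓ M c)) := by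
    simp only [tolConst, min_le_iff, le_refl, true_or, or_true, and_self]
  refine ⟨by positivity, ?_, ?_, ?_⟩
  · have := (le_div_iff₀ (by positivity)).1 (he.trans hgap)
    linarith
  · have := (le_div_iff₀ (by positivity)).1 (he.trans hsystem)
    linarith
  · have hne : n * e = tolConst d ℓ M c * ε := mul_div_cancel₀ _ hn0.ne'
    have hcore_mul := (le_div_iff₀ (by positivity)).1 hframe
    linear_combination (ε / 4) * hcore_mul + 2 * (d * (ℓ * ℓ) *
      (frameConst d ℓ M c * frameConst d ℓ M c) * coreConst d ℓ M c) * hne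

theorem unfoldingRank_le_card_right (k : Fin (n + 1)) (hk0 : k ≠ 0) (hk1 : k ≠ Fin.last n) :
    unfoldingRank p k ≤ sk.l k :=
  Nat.le_of_pred_lt (lt_of_singVal_pos (h.pos.trans_le (h.preservesRank k hk0 hk1)))

theorem unfoldingRank_le (k : Fin (n + 1)) : unfoldingRank p k ≤ ℓ := by
  by_cases hk0 : k = 0
  · exact hk0 ▸ (unfoldingRank_zero h.ne_zero).trans_le h.one_le_card
  by_cases hk1 : k = Fin.last n
  · exact hk1 ▸ (unfoldingRank_last h.ne_zero).trans_le h.one_le_card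
  · exact (h.unfoldingRank_le_card_right k hk0 hk1).trans (h.bounded.1 k).2

variable {r : Fin (n + 1) → ℕ} (hr : ∀ k, r k = unfoldingRank p k)
  {q : (k : Fin (n + 1)) → Matrix (Fin (sk.l k)) (Fin (r k)) ℝ} {p' : Config n d → ℝ} {e : ℝ}
include hr

theorem isStableGauge (he : 0 ≤ e) (hclose : sk.IsClose p p' e)
    (hgap : ℓ * d * (ℓ * e) ≤ gapConst d ℓ M c / 2)
    (hq : ∀ k : Fin n, k.succ ≠ Fin.last n → IsTruncatedGauge (sk.siteMoment p' k) (q k.succ))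
    (hqn : ∀ γ α, q (Fin.last n) γ α = 1) :
    sk.IsStableGauge p q (gaugeConst d ℓ M c) (bondConst d ℓ M c) where
  last := hqn
  abs_le := fun k γ α => by
    by_cases hk : k.succ = Fin.last n
    · have hone : ∀ j, j = Fin.last n → ∀ γ α, q j γ α = 1 := by
        rintro j rfl
        exact hqn
      rw [hone _ hk, abs_one]
      exact le_max_right _ _
    · exact (h.abs_gauge_apply_le hk he (hclose.2 k) hgap (hr _) (hq k hk) γ α).trans
        (le_max_left _ _)
  boundedBelow := fun k hk0 hk1 => by
    obtain ⟨j, rfl⟩ := Fin.exists_succ_eq.2 hk0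
    exact h.boundedBelow_bondMoment_mul_gauge hk1 he (hclose.2 j) hgap (hr _) (hq j hk1)

variable (hq : sk.IsStableGauge p q (gaugeConst d ℓ M c) (bondConst d ℓ M c))
include hq

theorem exists_isBondFrame_rightFrame (k : Fin (n + 1)) :
    ∃ E, IsBondFrame p k (rightFrame sk q k) E (frameConst d ℓ M c) ∧
      (k = 0 ∨ k = Fin.last n → ∀ x α, E x α = 1) := by
  by_cases hk : k = 0 ∨ k = Fin.last n
  · have hrk : r k = 1 := by
      rw [hr]
      rcases hk with rfl | rfl
      exacts [unfoldingRank_zero h.ne_zero, unfoldingRank_last h.ne_zero]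
    exact ⟨_, (isBondFrame_of_eq_one h.sum_eq_one hk hrk (rightFrame_eq_one hq.last hk)).mono
      (le_max_right _ _), fun _ _ _ => rfl⟩
  · obtain ⟨hk0, hk1⟩ := not_or.1 hk
    obtain ⟨j, rfl⟩ := Fin.exists_succ_eq.2 hk0
    obtain ⟨E, hE⟩ := h.exists_isBondFrame (hr _) h.bondConst_pos (gaugeConst_pos d ℓ M c).le
      (hq.abs_le j) (hq.boundedBelow _ hk0 hk1)
    exact ⟨E, rightFrame_succ sk q j ▸ hE.mono (le_max_left _ _), fun hk' => absurd hk' hk⟩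

theorem boundedBelow_pairing_rightFrame {k : Fin (n + 1)} (hk : k ≠ Fin.last n) :
    BoundedBelow (Matrix.of fun β α => pairing p (sk.S k · β) (rightFrame sk q k · α))
      (systemConst d ℓ M c) := by
  by_cases hk0 : k = 0
  · subst hk0
    have hr0 : r 0 = 1 := (hr 0).trans (unfoldingRank_zero h.ne_zero)
    refine (boundedBelow_of_apply_eq_one sk.m_zero hr0 fun β α => ?_).mono (min_le_right _ _)
    simp [pairing, rightFrame, sk.S_zero, h.sum_eq_one]
  · obtain ⟨j, rfl⟩ := Fin.exists_succ_eq.2 hk0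
    have hsystem : (Matrix.of fun β α => pairing p (sk.S j.succ · β)
        (rightFrame sk q j.succ · α)) = sk.bondMoment p j.succ * q j.succ := by
      ext β α
      rw [rightFrame_succ, Matrix.of_apply, pairing_gaugedSketch]
    rw [hsystem]
    exact (hq.boundedBelow _ hk0 hk).mono (min_le_left _ _)

end Sketch.IsAdapted

namespace Sketch.IsAdapted

variable {n d ℓ : ℕ} {sk : Sketch n d} {p p' : Config n d → ℝ} {M c e : ℝ}
  (h : sk.IsAdapted p ℓ M c) (he : 0 ≤ e) (hclose : sk.IsClose p p' e)
  {r : Fin (n + 1) → ℕ} {q : (k : Fin (n + 1)) → Matrix (Fin (sk.l k)) (Fin (r k)) ℝ}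
  (hq : sk.IsStableGauge p q (gaugeConst d ℓ M c) (bondConst d ℓ M c))
include h he hclose hq

theorem abs_system_sub_le {A : (k : Fin (n + 1)) → Matrix (Fin (sk.m k)) (Fin (r k)) ℝ}
    (hA0 : ∀ β α, A 0 β α = 1) (hA : ∀ k, k ≠ 0 → A k = sk.bondMoment p' k * q k)
    (k : Fin (n + 1)) (β : Fin (sk.m k)) (α : Fin (r k)) :
    |A k β α - pairing p (sk.S k · β) (rightFrame sk q k · α)| ≤
      ℓ * (e * gaugeConst d ℓ M c) := by
  have hκ := gaugeConst_pos d ℓ M c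
  by_cases hk0 : k = 0
  · subst hk0
    have hone : pairing p (sk.S 0 · β) (rightFrame sk q 0 · α) = 1 := by
      simp [pairing, rightFrame, sk.S_zero, h.sum_eq_one]
    rw [hone, hA0, sub_self, abs_zero]
    positivity
  · obtain ⟨j, rfl⟩ := Fin.exists_succ_eq.2 hk0
    rw [hA _ hk0, rightFrame_succ, pairing_gaugedSketch, ← Matrix.sub_apply, ← Matrix.sub_mul]
    refine (abs_dotProduct_le (fun γ => hclose.1 j.succ β γ) (hq.abs_le j · α)).trans ?_
    rw [Fintype.card_fin]
    exact mul_le_mul_of_nonneg_right (h.card_right _) (by positivity)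

theorem abs_rightHandSide_sub_le (k : Fin n) (a : Fin d) (β : Fin (sk.m k.castSucc))
    (α : Fin (r k.succ)) :
    |(sk.siteMoment p' k * q k.succ) (β, a) α - pairing p (sk.S k.castSucc · β)
      (fun x => siteIndicator k a x * rightFrame sk q k.succ x α)| ≤
      ℓ * (e * gaugeConst d ℓ M c) := by
  have hκ := gaugeConst_pos d ℓ M c
  rw [rightFrame_succ, pairing_siteIndicator_mul_gaugedSketch, ← Matrix.sub_apply,
    ← Matrix.sub_mul]
  refine (abs_dotProduct_le (fun γ => hclose.2 k (β, a) γ) (hq.abs_le k · α)).trans ?_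
  rw [Fintype.card_fin]
  exact mul_le_mul_of_nonneg_right (h.card_right _) (by positivity)

/-- The exact cores solve the exact linear systems, so the least squares solutions of the perturbed
systems are close to them. -/
theorem abs_leastSquares_sub_exactCore_le (hr : ∀ k, r k = unfoldingRank p k)
    (hsys : ℓ * (ℓ * (ℓ * (e * gaugeConst d ℓ M c))) ≤ systemConst d ℓ M c / 2)
    {A : (k : Fin (n + 1)) → Matrix (Fin (sk.m k)) (Fin (r k)) ℝ}
    (hA0 : ∀ β α, A 0 β α = 1) (hA : ∀ k, k ≠ 0 → A k = sk.bondMoment p' k * q k)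
    {E : (k : Fin (n + 1)) → Config n d → Fin (r k) → ℝ}
    (hE : ∀ k, IsBondFrame p k (rightFrame sk q k) (E k) (frameConst d ℓ M c)) {k : Fin n}
    {a : Fin d} {X : Matrix (Fin (r k.castSucc)) (Fin (r k.succ)) ℝ}
    (hX : IsLeastSquares (A k.castSucc) X
      (Matrix.of fun β α => (sk.siteMoment p' k * q k.succ) (β, a) α))
    (α : Fin (r k.castSucc)) (α' : Fin (r k.succ)) :
    |X α α' - exactCore p (rightFrame sk q) E k a α α'| ≤ coreConst d ℓ M c * e := by
  have hκ := gaugeConst_pos d ℓ M c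
  have hK := frameConst_pos d ℓ M c
  have hτ := h.systemConst_pos
  have hsystem := h.boundedBelow_pairing_rightFrame hr hq (Fin.castSucc_lt_last k).ne
  have hexact : Matrix.of (fun β α => pairing p (sk.S k.castSucc · β)
      (rightFrame sk q k.castSucc · α)) *ᵥ (fun α => exactCore p (rightFrame sk q) E k a α α') =
      fun β => pairing p (sk.S k.castSucc · β)
        (fun x => siteIndicator k a x * rightFrame sk q k.succ x α') := funext fun β =>
    ((hE k.castSucc).pairing_eq _ _ (dependsOn_apply (sk.S_dependsOn _) β)
      (dependsOn_siteIndicator_mul (dependsOn_apply (hE k.succ).right_dependsOn α'))).symm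
  have hbound : ∀ α, |exactCore p (rightFrame sk q) E k a α α'| ≤
      frameConst d ℓ M c * frameConst d ℓ M c := fun α =>
    abs_pairing_le h.nonneg h.sum_eq_one (fun x => (hE _).left_le x α)
      (fun x => (abs_siteIndicator_mul_le k a x _).trans ((hE _).right_le x α')) hK.le
  have hnorm := hsystem.norm_leastSquares_sub_le (h.bounded.1 k.castSucc).1
    ((hr _).trans_le (h.unfoldingRank_le _)) (h.abs_system_sub_le he hclose hq hA0 hA k.castSucc)
    (by positivity) hsys (h.abs_rightHandSide_sub_le he hclose hq k a · α') hbound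
    (by positivity) hexact (g' := fun α => X α α')
    (funext fun i => congrFun (congrFun hX i) α')
  refine (abs_apply_le_norm_toLp ((fun α => X α α') - fun α => exactCore p (rightFrame sk q) E k a
    α α') α).trans ?_
  rw [coreConst, div_mul_eq_mul_div, div_mul_eq_mul_div, le_div_iff₀ hτ]
  linear_combination 2 * hnorm

end Sketch.IsAdapted

theorem Sketch.IsAdapted.sum_abs_eval_sub_le_of_isClose {n d ℓ : ℕ} {sk : Sketch n d}
    {p p' : Config n d → ℝ} {M c ε : ℝ} (h : sk.IsAdapted p ℓ M c) (hn : 1 ≤ n) (hε : 0 < ε)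
    (hε1 : ε ≤ 1) (hclose : sk.IsClose p p' (tolConst d ℓ M c * ε / n)) {ψ : MPS n d}
    (hψ : IsTTNSSketchOutput sk p' (unfoldingRank p) ψ) : ∑ x, |ψ.eval x - p x| ≤ ε / 4 := by
  obtain ⟨hr, q, A, hgauge, hqn, hA0, hA, hls⟩ := hψ
  have : (0 : ℝ) < n := by exact_mod_cast hn
  obtain ⟨he, hgap, hsys, hfinal⟩ := h.tolConst_spec hn hε hε1
  have hq := h.isStableGauge hr he hclose hgap hgauge hqn
  choose E hE hE1 using h.exists_isBondFrame_rightFrame hr hq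
  exact (sum_abs_eval_sub_le hE h.nonneg (frameConst_pos d ℓ M c).le
    (fun k => (hr k).trans_le (h.unfoldingRank_le k)) (mul_nonneg h.coreConst_pos.le he)
    h.sum_eq_one
    (fun k a => h.abs_leastSquares_sub_exactCore_le he hclose hq hr hsys hA0 hA hE (hls k a))
    (hE1 0 (Or.inl rfl)) (hfinal.trans (by linarith)) (hE1 _ (Or.inr rfl))).trans hfinal

/-! ### Errors and existence of the output -/

theorem MPS.norm_sub_lt_of_sum_abs_sub_le {n d : ℕ} {p : Config n d → ℝ} (hp : ∀ x, 0 ≤ p x)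
    (hp1 : ∑ x, p x = 1) {ψ : MPS n d} {ε : ℝ} (hε : 0 < ε) (hε1 : ε ≤ 1)
    (h : ∑ x, |ψ.eval x - p x| ≤ ε / 4) :
    ψ.weight ≠ 0 ∧ ‖p - ψ.directDensity‖ < ε ∧ ‖p - ψ.eval‖ < ε := by
  have heval : ∀ x, |p x - ψ.eval x| ≤ ε / 4 := fun x =>
    abs_sub_comm (p x) (ψ.eval x) ▸ (Finset.single_le_sum (f := fun x => |ψ.eval x - p x|)
      (fun y _ => abs_nonneg _) (Finset.mem_univ x)).trans h
  have hple : ∀ x, p x ≤ 1 := fun x => hp1 ▸ Finset.single_le_sum (f := p) (fun y _ => hp y)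
    (Finset.mem_univ x)
  have hweight : |ψ.weight - 1| ≤ ε / 4 := by
    rw [MPS.weight, ← hp1, ← Finset.sum_sub_distrib]
    exact (Finset.abs_sum_le_sum_abs _ _).trans h
  have hlower : 3 / 4 ≤ ψ.weight := by linarith [(abs_le.1 hweight).1]
  have hpos : 0 < ψ.weight := by linarith
  refine ⟨hpos.ne', (pi_norm_lt_iff hε).2 fun x => ?_, (pi_norm_lt_iff hε).2 fun x => ?_⟩
  · have hsplit : p x - ψ.eval x / ψ.weight =
        ((p x - ψ.eval x) + p x * (ψ.weight - 1)) / ψ.weight := by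
      field_simp
      ring
    have hrescale : |p x * (ψ.weight - 1)| ≤ 1 * (ε / 4) := by
      rw [abs_mul, abs_of_nonneg (hp x)]
      exact mul_le_mul (hple x) hweight (abs_nonneg _) zero_le_one
    rw [Pi.sub_apply, MPS.directDensity, Real.norm_eq_abs, hsplit, abs_div, abs_of_pos hpos,
      div_lt_iff₀ hpos]
    calc |(p x - ψ.eval x) + p x * (ψ.weight - 1)|
        ≤ |p x - ψ.eval x| + |p x * (ψ.weight - 1)| := abs_add_le _ _
      _ ≤ ε / 4 + 1 * (ε / 4) := add_le_add (heval x) hrescale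
      _ < ε * (3 / 4) := by linarith
      _ ≤ ε * ψ.weight := mul_le_mul_of_nonneg_left hlower hε.le
  · rw [Pi.sub_apply, Real.norm_eq_abs]
    linarith [heval x]

section Existence

theorem exists_isLeastSquares {m R s : ℕ} (A : Matrix (Fin m) (Fin R) ℝ)
    (B : Matrix (Fin m) (Fin s) ℝ) : ∃ X, IsLeastSquares A X B := by
  have hle : LinearMap.range (Aᵀ * A).mulVecLin ≤ LinearMap.range Aᵀ.mulVecLin := by
    rintro _ ⟨u, rfl⟩
    exact ⟨A *ᵥ u, by simp⟩
  have hrange : LinearMap.range (Aᵀ * A).mulVecLin = LinearMap.range Aᵀ.mulVecLin :=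
    Submodule.eq_of_le_of_finrank_eq hle
      ((Matrix.rank_transpose_mul_self A).trans (Matrix.rank_transpose A).symm)
  have hcol : ∀ j, (Aᵀ *ᵥ fun i => B i j) ∈ LinearMap.range (Aᵀ * A).mulVecLin := fun j =>
    hrange ▸ ⟨_, rfl⟩
  choose u hu using hcol
  exact ⟨Matrix.of fun i j => u j i, Matrix.ext fun i j => congrFun (hu j) i⟩

variable {n d : ℕ}

theorem exists_isTruncatedGauge_siteMoment {sk : Sketch n d} {R : Fin (n + 1) → ℕ}
    (hR : ∀ k, k ≠ 0 → k ≠ Fin.last n → R k ≤ sk.l k) (p : Config n d → ℝ) :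
    ∃ q : (k : Fin (n + 1)) → Matrix (Fin (sk.l k)) (Fin (R k)) ℝ,
      (∀ k : Fin n, k.succ ≠ Fin.last n → IsTruncatedGauge (sk.siteMoment p k) (q k.succ)) ∧
      ∀ γ α, q (Fin.last n) γ α = 1 := by
  have hsite : ∀ j : Fin n, ∃ q : Matrix (Fin (sk.l j.succ)) (Fin (R j.succ)) ℝ,
      (j.succ ≠ Fin.last n → IsTruncatedGauge (sk.siteMoment p j) q) ∧
      (j.succ = Fin.last n → ∀ γ α, q γ α = 1) := fun j => by
    by_cases hj : j.succ = Fin.last n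
    · exact ⟨fun _ _ => 1, fun h => absurd hj h, fun _ _ _ => rfl⟩
    · obtain ⟨q, hq⟩ := exists_isTruncatedGauge (sk.siteMoment p j) (hR _ (Fin.succ_ne_zero j) hj)
      exact ⟨q, fun _ => hq, fun h => absurd h hj⟩
  choose q hgauge hlast using hsite
  refine ⟨Fin.cons (fun _ _ => 1) q, hgauge, ?_⟩
  cases n with
  | zero => exact fun _ _ => rfl
  | succ n => exact hlast (Fin.last n) rfl

theorem exists_isTTNSSketchOutput {sk : Sketch n d} {R : Fin (n + 1) → ℕ} (hR0 : R 0 = 1)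
    (hRn : R (Fin.last n) = 1) (hR : ∀ k, k ≠ 0 → k ≠ Fin.last n → R k ≤ sk.l k)
    (p : Config n d → ℝ) : ∃ ψ : MPS n d, IsTTNSSketchOutput sk p R ψ := by
  obtain ⟨q, hgauge, hlast⟩ := exists_isTruncatedGauge_siteMoment hR p
  let A : (k : Fin (n + 1)) → Matrix (Fin (sk.m k)) (Fin (R k)) ℝ := fun k =>
    if k = 0 then fun _ _ => 1 else sk.bondMoment p k * q k
  choose X hX using fun (k : Fin n) (a : Fin d) => exists_isLeastSquares (A k.castSucc)
    (Matrix.of fun β α => (sk.siteMoment p k * q k.succ) (β, a) α)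
  exact ⟨⟨R, hR0, hRn, X⟩, fun _ => rfl, q, A, hgauge, hlast,
    fun β α => by simp [A], fun k hk => if_neg hk, hX⟩

end Existence

/-! ### Ranks of Born machines -/

namespace MPS

variable {n d : ℕ} (θ : MPS n d)

/-- The product of the cores to the right of the bond `k`. -/
def rightProd (k : Fin (n + 1)) : Config n d → Fin (θ.bond k) → ℝ :=
  Fin.reverseInduction (motive := fun k => Config n d → Fin (θ.bond k) → ℝ) (fun _ _ => 1)
    (fun k H x α => ∑ α', θ.core k (x k) α α' * H x α') k

theorem rightProd_last (x : Config n d) (α : Fin (θ.bond (Fin.last n))) :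
    θ.rightProd (Fin.last n) x α = 1 := by
  simp only [rightProd, Fin.reverseInduction_last]

theorem rightProd_castSucc (k : Fin n) (x : Config n d) (α : Fin (θ.bond k.castSucc)) :
    θ.rightProd k.castSucc x α = ∑ α', θ.core k (x k) α α' * θ.rightProd k.succ x α' := by
  simp only [rightProd, Fin.reverseInduction_castSucc]

theorem rightProd_dependsOn (k : Fin (n + 1)) : DependsOn (θ.rightProd k) (rightSites k) := by
  induction k using Fin.reverseInduction with
  | last =>
    intro x y _
    ext α
    rw [rightProd_last, rightProd_last]
  | cast k ih =>
    intro x y h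
    ext α
    rw [rightProd_castSucc, rightProd_castSucc, h k (lt_irrefl _),
      ih fun i hi => h i fun hlt => hi (lt_trans hlt Fin.castSucc_lt_succ)]

theorem eval_eq_sum_leftProd_mul_rightProd (k : Fin (n + 1)) (x : Config n d) :
    θ.eval x = ∑ α, θ.leftProd k x α * θ.rightProd k x α := by
  induction k using Fin.reverseInduction with
  | last => simp only [rightProd_last, mul_one, eval_eq_sum_leftProd]
  | cast k ih =>
    rw [ih]
    simp only [leftProd_succ, rightProd_castSucc, Finset.sum_mul, Finset.mul_sum, mul_assoc]
    exact Finset.sum_comm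

theorem bornDensity_eq_sum (k : Fin (n + 1)) (x : Config n d) :
    θ.bornDensity x = ∑ i : Fin (θ.bond k) × Fin (θ.bond k),
      (θ.leftProd k x i.1 * θ.leftProd k x i.2 / ∑ z, |θ.eval z| ^ 2) *
        (θ.rightProd k x i.1 * θ.rightProd k x i.2) := by
  rw [bornDensity, sq_abs, sq, θ.eval_eq_sum_leftProd_mul_rightProd k, Finset.sum_mul_sum,
    Fintype.sum_prod_type]
  simp only [Finset.sum_div]
  exact Finset.sum_congr rfl fun α _ => Finset.sum_congr rfl fun α' _ => by ring

end MPS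

section Ranks

variable {n d : ℕ}

theorem unfoldingRank_le_card_of_eq_sum {ι : Type*} [Fintype ι] {p : Config n d → ℝ}
    {k : Fin (n + 1)} (x₀ : Config n d) {F G : ι → Config n d → ℝ}
    (hF : ∀ i, DependsOn (F i) (leftSites k)) (hG : ∀ i, DependsOn (G i) (rightSites k))
    (h : ∀ x, p x = ∑ i, F i x * G i x) : unfoldingRank p k ≤ Fintype.card ι := by
  have hfactor : unfolding p k =
      (Matrix.of fun y i => F i ((splitAt k).symm (y, (splitAt k x₀).2))) *
      (Matrix.of fun i z => G i ((splitAt k).symm ((splitAt k x₀).1, z))) := by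
    ext y z
    rw [Matrix.mul_apply]
    refine (h ((splitAt k).symm (y, z))).trans (Finset.sum_congr rfl fun i _ => congrArg₂ _ ?_ ?_)
    · exact hF i fun j hj => by rw [splitAt_symm_left _ _ hj, splitAt_symm_left _ _ hj]
    · exact hG i fun j hj => by rw [splitAt_symm_right _ _ hj, splitAt_symm_right _ _ hj]
  rw [unfoldingRank, hfactor]
  exact (Matrix.rank_mul_le_left _ _).trans (Matrix.rank_le_card_width _)

theorem massFn_nonneg (p : PMF (Config n d)) (x : Config n d) : 0 ≤ massFn p x :=
  ENNReal.toReal_nonneg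

theorem sum_massFn (p : PMF (Config n d)) : ∑ x, massFn p x = 1 := by
  have htotal := p.tsum_coe
  rw [tsum_fintype] at htotal
  simp only [massFn]
  rw [← ENNReal.toReal_sum fun x _ => p.apply_ne_top x, htotal, ENNReal.toReal_one]

theorem massFn_ne_zero (p : PMF (Config n d)) : massFn p ≠ 0 := fun h => by
  simpa only [h, Pi.zero_apply, Finset.sum_const_zero, zero_ne_one] using sum_massFn p

theorem IsBornMachine.unfoldingRank_le {p : PMF (Config n d)} {θ : MPS n d}
    (h : IsBornMachine p θ) (k : Fin (n + 1)) : unfoldingRank (massFn p) k ≤ θ.bond k ^ 2 :=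
  calc unfoldingRank (massFn p) k ≤ Fintype.card (Fin (θ.bond k) × Fin (θ.bond k)) :=
        unfoldingRank_le_card_of_eq_sum p.support_nonempty.some
          (fun i x y hxy => by simp only [θ.leftProd_dependsOn k hxy])
          (fun i x y hxy => by simp only [θ.rightProd_dependsOn k hxy])
          fun x => (h x).trans (θ.bornDensity_eq_sum k x)
    _ = θ.bond k ^ 2 := by rw [Fintype.card_prod, Fintype.card_fin, sq]

theorem exists_submatrix_rows_rank_eq {ι κ K : Type*} [Finite ι] [Fintype κ] [Field K] {R : ℕ}
    {A : Matrix ι κ K} (hR : A.rank = R) : ∃ r : Fin R → ι, (A.submatrix r id).rank = R := by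
  have := Fintype.ofFinite ι
  obtain ⟨σ, a, ha, hspan, hli⟩ := exists_linearIndependent' K A.row
  have := Fintype.ofInjective a ha
  have hcard : Fintype.card σ = R := by
    rw [← hR, Matrix.rank_eq_finrank_span_row, ← hspan, finrank_span_eq_card hli]
  let e : Fin R ≃ σ := (Fintype.equivFinOfCardEq hcard).symm
  have hrows : LinearIndependent K (A.submatrix (a ∘ e) id).row := hli.comp e e.injective
  exact ⟨a ∘ e, by rw [hrows.rank_matrix, Fintype.card_fin]⟩

theorem exists_submatrix_rank_eq {ι κ K : Type*} [Finite ι] [Fintype κ] [Field K] {R : ℕ}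
    {A : Matrix ι κ K} (hR : A.rank = R) :
    ∃ (r : Fin R → ι) (s : Fin R → κ), (A.submatrix r s).rank = R := by
  obtain ⟨r, hr⟩ := exists_submatrix_rows_rank_eq hR
  obtain ⟨s, hs⟩ := exists_submatrix_rows_rank_eq ((Matrix.rank_transpose _).trans hr)
  exact ⟨r, s, (Matrix.rank_transpose _).symm.trans hs⟩

/-- The sketches by indicator functions of configurations `r` of the left and `s` of the right
sites: they select a square submatrix of every unfolding of `p`. -/
def indicatorSketch {p : Config n d → ℝ} (hp : p ≠ 0)
    (r : (k : Fin (n + 1)) → Fin (unfoldingRank p k) → {i : Fin n // i.castSucc < k} → Fin d)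
    (s : (k : Fin (n + 1)) → Fin (unfoldingRank p k) → {i : Fin n // ¬ i.castSucc < k} → Fin d) :
    Sketch n d where
  m := unfoldingRank p
  l := unfoldingRank p
  S k x β := if (splitAt k x).1 = r k β then 1 else 0
  T k x γ := if (splitAt k x).2 = s k γ then 1 else 0
  S_dependsOn k x y h := by
    have hleft : (splitAt k x).1 = (splitAt k y).1 := funext fun i => h i i.2
    simp only [hleft]
  T_dependsOn k x y h := by
    have hright : (splitAt k x).2 = (splitAt k y).2 := funext fun i => h i i.2
    simp only [hright]
  m_zero := unfoldingRank_zero hp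
  l_last := unfoldingRank_last hp
  S_zero x β := if_pos (funext fun i => absurd i.2 (Fin.not_lt_zero _))
  T_last x γ := if_pos (funext fun i => absurd (Fin.castSucc_lt_last _) i.2)

theorem bondMoment_indicatorSketch {p : Config n d → ℝ} (hp : p ≠ 0)
    (r : (k : Fin (n + 1)) → Fin (unfoldingRank p k) → {i : Fin n // i.castSucc < k} → Fin d)
    (s : (k : Fin (n + 1)) → Fin (unfoldingRank p k) → {i : Fin n // ¬ i.castSucc < k} → Fin d)
    (k : Fin (n + 1)) :
    (indicatorSketch hp r s).bondMoment p k = (unfolding p k).submatrix (r k) (s k) := by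
  ext β γ
  refine (Fintype.sum_eq_single ((splitAt k).symm (r k β, s k γ)) fun x hx => ?_).trans ?_
  · by_cases hleft : (splitAt k x).1 = r k β
    · have hright : (splitAt k x).2 ≠ s k γ := fun hright => hx (by
        rw [← hleft, ← hright, Prod.mk.eta, Equiv.symm_apply_apply])
      exact mul_eq_zero_of_right _ (if_neg hright)
    · exact mul_eq_zero_of_left (mul_eq_zero_of_left (if_neg hleft) _) _
  · simp only [indicatorSketch, Equiv.apply_symm_apply, if_true, one_mul, mul_one]
    rfl

theorem exists_sketch_preservesRank {p : Config n d → ℝ} (hp : p ≠ 0) :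
    ∃ (sk : Sketch n d) (c : ℝ), 0 < c ∧
      (∀ k, sk.m k = unfoldingRank p k ∧ sk.l k = unfoldingRank p k) ∧
      (∀ k x β, |sk.S k x β| ≤ 1) ∧ (∀ k x γ, |sk.T k x γ| ≤ 1) ∧ sk.PreservesRank p c := by
  choose r s hrs using fun k =>
    exists_submatrix_rank_eq (A := unfolding p k) (R := unfoldingRank p k) rfl
  let σ : Fin (n + 1) → ℝ := fun k =>
    singVal ((indicatorSketch hp r s).bondMoment p k) (unfoldingRank p k - 1)
  have hσ : ∀ k, 0 < σ k := fun k => by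
    refine singVal_pos_of_lt_rank ?_
    rw [bondMoment_indicatorSketch]
    exact (Nat.sub_lt (unfoldingRank_pos hp k) one_pos).trans_eq (hrs k).symm
  refine ⟨indicatorSketch hp r s, Finset.univ.inf' Finset.univ_nonempty σ,
    (Finset.lt_inf'_iff _).2 fun k _ => hσ k, fun _ => ⟨rfl, rfl⟩, fun k x β => ?_,
    fun k x γ => ?_, fun k _ _ => Finset.inf'_le σ (Finset.mem_univ k)⟩ <;>
  · simp only [indicatorSketch]
    split_ifs <;> simp

end Ranks

/-! ### Concentration of sketched empirical distributions -/

section Sampling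

variable {n d : ℕ}

theorem sum_empirical_mul {B : ℕ} (ω : Fin B → Config n d) (g : Config n d → ℝ) :
    ∑ x, empirical ω x * g x = (∑ b, g (ω b)) / B := by
  have hcount : ∀ x, empirical ω x * g x = (∑ b, if ω b = x then g x else 0) / B := fun x => by
    rw [empirical, div_mul_eq_mul_div, ← Finset.sum_filter, Finset.sum_const, nsmul_eq_mul]
  simp only [hcount, ← Finset.sum_div]
  rw [Finset.sum_comm]
  simp

instance isProbabilityMeasure_sampleLaw (p : PMF (Config n d)) (B : ℕ) :
    IsProbabilityMeasure (sampleLaw p B) := by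
  unfold sampleLaw
  infer_instance

theorem integral_eval_sampleLaw (p : PMF (Config n d)) {B : ℕ} (f : Config n d → ℝ) (b : Fin B) :
    ∫ ω, f (ω b) ∂sampleLaw p B = ∑ x, massFn p x * f x := by
  have heval := measurePreserving_eval (fun _ : Fin B => p.toMeasure) b
  calc ∫ ω, f (ω b) ∂sampleLaw p B = ∫ x, f x ∂p.toMeasure := by
        rw [← heval.map_eq, integral_map heval.measurable.aemeasurable
          (measurable_of_finite f).aestronglyMeasurable]
        rfl
    _ = ∑ x, massFn p x * f x := PMF.integral_eq_sum p f

open ProbabilityTheory in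
theorem measureReal_le_sum_sub_le (p : PMF (Config n d)) (B : ℕ) {f : Config n d → ℝ} {K t : ℝ}
    (hK : 0 ≤ K) (hf : ∀ x, |f x| ≤ K) (ht : 0 ≤ t) :
    (sampleLaw p B).real {ω | t ≤ ∑ b, (f (ω b) - ∑ x, massFn p x * f x)} ≤
      Real.exp (-t ^ 2 / (2 * (B * K ^ 2))) := by
  have hindep : iIndepFun (fun (b : Fin B) (ω : Fin B → Config n d) =>
      f (ω b) - ∑ x, massFn p x * f x) (sampleLaw p B) :=
    iIndepFun_pi (X := fun _ x => f x - ∑ x, massFn p x * f x)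
      fun b => (measurable_of_finite _).aemeasurable
  have hsub : ∀ b ∈ (Finset.univ : Finset (Fin B)), HasSubgaussianMGF
      (fun ω : Fin B → Config n d => f (ω b) - ∑ x, massFn p x * f x)
      ((‖K - (-K)‖₊ / 2) ^ 2) (sampleLaw p B) := fun b _ => by
    rw [← integral_eval_sampleLaw p f b]
    exact hasSubgaussianMGF_of_mem_Icc
      ((measurable_of_finite f).comp (measurable_pi_apply b)).aemeasurable
      (Filter.Eventually.of_forall fun ω => abs_le.1 (hf (ω b)))
  refine (HasSubgaussianMGF.measure_sum_ge_le_of_iIndepFun hindep hsub ht).trans_eq ?_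
  have hwidth : ‖K - (-K)‖ / 2 = K := by
    rw [Real.norm_eq_abs, abs_of_nonneg (by linarith)]
    ring
  simp only [Finset.sum_const, Finset.card_univ, Fintype.card_fin, nsmul_eq_mul, NNReal.coe_mul,
    NNReal.coe_natCast, NNReal.coe_pow, NNReal.coe_div, coe_nnnorm, NNReal.coe_ofNat, hwidth]

theorem measureReal_lt_abs_empirical_sub_le (p : PMF (Config n d)) {B : ℕ} (hB : 0 < B)
    {f : Config n d → ℝ} {K e : ℝ} (hf : ∀ x, |f x| ≤ K) (he : 0 ≤ e) :
    (sampleLaw p B).real {ω | e < |∑ x, empirical ω x * f x - ∑ x, massFn p x * f x|} ≤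
      2 * Real.exp (-(e ^ 2 * B / (2 * K ^ 2))) := by
  have hB' : (0 : ℝ) < B := Nat.cast_pos.2 hB
  have hK : 0 ≤ K := (abs_nonneg _).trans (hf p.support_nonempty.some)
  have hupper := measureReal_le_sum_sub_le p B hK hf (mul_nonneg he hB'.le)
  have hlower := measureReal_le_sum_sub_le p B (f := fun x => -f x) hK (by simpa using hf)
    (mul_nonneg he hB'.le)
  have hexp : -(e * B) ^ 2 / (2 * (B * K ^ 2)) = -(e ^ 2 * B / (2 * K ^ 2)) := by
    field_simp
  rw [hexp] at hupper hlower
  rw [two_mul]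
  refine (measureReal_mono fun ω hω => ?_).trans
    ((measureReal_union_le _ _).trans (add_le_add hupper hlower))
  set μ := ∑ x, massFn p x * f x
  have hsum : ∑ b, (f (ω b) - μ) = (∑ x, empirical ω x * f x - μ) * B := by
    simp only [sum_empirical_mul, Finset.sum_sub_distrib, Finset.sum_const, Finset.card_univ,
      Fintype.card_fin, nsmul_eq_mul]
    field_simp
  have hsum_neg : ∑ b, (-f (ω b) - ∑ x, massFn p x * -f x) = -∑ b, (f (ω b) - μ) := by
    rw [← Finset.sum_neg_distrib]
    refine Finset.sum_congr rfl fun b _ => ?_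
    simp only [mul_neg, Finset.sum_neg_distrib, neg_sub, sub_neg_eq_add]
    ring
  rcases lt_abs.1 hω.out with hgt | hlt
  · exact Or.inl ((mul_le_mul_of_nonneg_right hgt.le hB'.le).trans_eq hsum.symm)
  · refine Or.inr ((mul_le_mul_of_nonneg_right hlt.le hB'.le).trans_eq ?_)
    rw [hsum_neg, hsum, neg_mul]

theorem measureReal_iUnion_le_card_mul {Ω κ : Type*} [MeasurableSpace Ω] [Fintype κ]
    (μ : Measure Ω) {s : κ → Set Ω} {a : ℝ} (h : ∀ i, μ.real (s i) ≤ a) :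
    μ.real (⋃ i, s i) ≤ Fintype.card κ * a :=
  calc μ.real (⋃ i, s i) ≤ ∑ i, μ.real (s i) := measureReal_iUnion_fintype_le s
    _ ≤ ∑ _i : κ, a := Finset.sum_le_sum fun i _ => h i
    _ = Fintype.card κ * a := by rw [Finset.sum_const, Finset.card_univ, nsmul_eq_mul]

variable {sk : Sketch n d} {ℓ : ℕ} {M e : ℝ} (hsk : sk.BoundedBy ℓ M)
include hsk

theorem Sketch.BoundedBy.abs_mul_le {k k' : Fin (n + 1)} (x : Config n d) (β : Fin (sk.m k))
    {t : ℝ} {γ : Fin (sk.l k')} (ht : |t| ≤ |sk.T k' x γ|) : |sk.S k x β * t| ≤ M * M := by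
  have hS := hsk.2.1 k x β
  rw [abs_mul]
  exact mul_le_mul hS (ht.trans (hsk.2.2 k' x γ)) (abs_nonneg _) ((abs_nonneg _).trans hS)

variable (p : PMF (Config n d)) {B : ℕ} (hB : 0 < B) (he : 0 ≤ e)
include hB he

theorem Sketch.BoundedBy.measureReal_lt_abs_bondMoment_sub_le (k : Fin (n + 1))
    (β : Fin (sk.m k)) (γ : Fin (sk.l k)) :
    (sampleLaw p B).real
      {ω | e < |sk.bondMoment (empirical ω) k β γ - sk.bondMoment (massFn p) k β γ|} ≤
      2 * Real.exp (-(e ^ 2 * B / (2 * (M * M) ^ 2))) := by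
  have hentry : ∀ p' : Config n d → ℝ,
      sk.bondMoment p' k β γ = ∑ x, p' x * (sk.S k x β * sk.T k x γ) :=
    fun p' => Finset.sum_congr rfl fun x _ => by ring
  simp only [hentry]
  exact measureReal_lt_abs_empirical_sub_le p hB (fun x => hsk.abs_mul_le x β le_rfl) he

theorem Sketch.BoundedBy.measureReal_lt_abs_siteMoment_sub_le (k : Fin n)
    (βa : Fin (sk.m k.castSucc) × Fin d) (γ : Fin (sk.l k.succ)) :
    (sampleLaw p B).real
      {ω | e < |sk.siteMoment (empirical ω) k βa γ - sk.siteMoment (massFn p) k βa γ|} ≤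
      2 * Real.exp (-(e ^ 2 * B / (2 * (M * M) ^ 2))) := by
  obtain ⟨β, a⟩ := βa
  have hentry : ∀ p' : Config n d → ℝ, sk.siteMoment p' k (β, a) γ =
      ∑ x, p' x * (sk.S k.castSucc x β * (siteIndicator k a x * sk.T k.succ x γ)) := fun p' => by
    rw [sk.siteMoment_eq_pairing]
    exact Finset.sum_congr rfl fun x _ => by ring
  simp only [hentry]
  exact measureReal_lt_abs_empirical_sub_le p hB
    (fun x => hsk.abs_mul_le x β (abs_siteIndicator_mul_le k a x _)) he

theorem Sketch.BoundedBy.measureReal_not_isClose_le :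
    (sampleLaw p B).real {ω | ¬ sk.IsClose (massFn p) (empirical ω) e} ≤
      ((n + 1) * (ℓ * ℓ) + n * (ℓ * d * ℓ)) *
        (2 * Real.exp (-(e ^ 2 * B / (2 * (M * M) ^ 2)))) := by
  have hbond := measureReal_iUnion_le_card_mul (sampleLaw p B)
    (κ := (k : Fin (n + 1)) × Fin (sk.m k) × Fin (sk.l k)) fun i =>
    hsk.measureReal_lt_abs_bondMoment_sub_le p hB he i.1 i.2.1 i.2.2
  have hsite := measureReal_iUnion_le_card_mul (sampleLaw p B)
    (κ := (k : Fin n) × (Fin (sk.m k.castSucc) × Fin d) × Fin (sk.l k.succ)) fun i =>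
    hsk.measureReal_lt_abs_siteMoment_sub_le p hB he i.1 i.2.1 i.2.2
  have hbond_card : Fintype.card ((k : Fin (n + 1)) × Fin (sk.m k) × Fin (sk.l k)) ≤
      (n + 1) * (ℓ * ℓ) := by
    simp only [Fintype.card_sigma, Fintype.card_prod, Fintype.card_fin]
    refine (Finset.sum_le_card_nsmul _ _ (ℓ * ℓ) fun k _ =>
      Nat.mul_le_mul (hsk.1 k).1 (hsk.1 k).2).trans_eq ?_
    rw [Finset.card_univ, Fintype.card_fin, smul_eq_mul]
  have hsite_card : Fintype.card ((k : Fin n) × (Fin (sk.m k.castSucc) × Fin d) ×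
      Fin (sk.l k.succ)) ≤ n * (ℓ * d * ℓ) := by
    simp only [Fintype.card_sigma, Fintype.card_prod, Fintype.card_fin]
    refine (Finset.sum_le_card_nsmul _ _ (ℓ * d * ℓ) fun k _ =>
      Nat.mul_le_mul (Nat.mul_le_mul_right d (hsk.1 _).1) (hsk.1 _).2).trans_eq ?_
    rw [Finset.card_univ, Fintype.card_fin, smul_eq_mul]
  refine (measureReal_mono fun ω hω => ?_).trans ((measureReal_union_le _ _).trans
    ((add_le_add hbond hsite).trans ?_))
  · by_contra hfar
    simp only [Set.mem_union, Set.mem_iUnion, Set.mem_ofPred_eq, not_or, not_exists, not_lt] at hfar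
    exact hω ⟨fun k β γ => hfar.1 ⟨k, β, γ⟩, fun k βa γ => hfar.2 ⟨k, βa, γ⟩⟩
  · rw [← add_mul]
    refine mul_le_mul_of_nonneg_right (add_le_add ?_ ?_) (by positivity)
    exacts [by exact_mod_cast hbond_card, by exact_mod_cast hsite_card]

end Sampling

theorem mul_exp_neg_mul_log_le (s : ℕ) {n : ℕ} (hn : 1 ≤ n) {δ : ℝ} (hδ : 0 < δ) (hδ1 : δ ≤ 1) :
    (n * s : ℝ) * (2 * Real.exp (-((1 + s : ℕ) * Real.log (2 * n / δ)))) ≤ δ := by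
  have hn' : (1 : ℝ) ≤ n := by exact_mod_cast hn
  set y := 2 * (n : ℝ) / δ with hy
  have hyδ : 2 * (n : ℝ) = δ * y := (mul_div_cancel₀ _ hδ.ne').symm
  have hy2 : 2 ≤ y := by
    rw [hy, le_div_iff₀ hδ]
    linarith
  have hy0 : 0 < y := by linarith
  have hs : (s : ℝ) ≤ y ^ s :=
    calc (s : ℝ) ≤ 2 ^ s := by exact_mod_cast Nat.lt_two_pow_self.le
      _ ≤ y ^ s := pow_le_pow_left₀ zero_le_two hy2 s
  have hexp : Real.exp (-((1 + s : ℕ) * Real.log y)) = (y * y ^ s)⁻¹ := by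
    rw [Real.exp_neg, Real.exp_nat_mul, Real.exp_log hy0, pow_add, pow_one]
  calc (n * s : ℝ) * (2 * Real.exp (-((1 + s : ℕ) * Real.log y)))
      = (2 * n) * s / (y * y ^ s) := by
        rw [hexp]
        ring
    _ = δ * (s / y ^ s) := by
        rw [hyδ]
        field_simp
    _ ≤ δ := mul_le_of_le_one_right hδ.le ((div_le_one (by positivity)).2 hs)

/-- The constant of the sample complexity bound. The factor `1 + ℓ * ℓ * (2 + d)` pays for the union
bound over the entries of the sketched tensors, which are at most `n * (ℓ * ℓ * (2 + d))`. -/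
def sampleConst (d ℓ : ℕ) (M c : ℝ) : ℝ :=
  max 1 (2 * (M * M) ^ 2 * (1 + ℓ * ℓ * (2 + d) : ℕ) / tolConst d ℓ M c ^ 2)

theorem sampleConst_pos (d ℓ : ℕ) (M c : ℝ) : 0 < sampleConst d ℓ M c :=
  lt_max_of_lt_left one_pos

namespace Sketch.IsAdapted

theorem mul_log_le_of_sampleConst_le {n d ℓ : ℕ} {sk : Sketch n d} {p : Config n d → ℝ}
    {M c ε δ : ℝ} (h : sk.IsAdapted p ℓ M c) (hn : 1 ≤ n) (hε : 0 < ε)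
    (hlog : 0 ≤ Real.log (2 * n / δ)) {B : ℕ}
    (hB : sampleConst d ℓ M c * (((n : ℝ) ^ 2 + ε * n) / ε ^ 2) * Real.log (2 * n / δ) ≤ B) :
    (1 + ℓ * ℓ * (2 + d) : ℕ) * Real.log (2 * n / δ) ≤
      (tolConst d ℓ M c * ε / n) ^ 2 * B / (2 * (M * M) ^ 2) := by
  have htol := h.tolConst_pos
  have hM := h.bound_pos
  have : (0 : ℝ) < n := Nat.cast_pos.2 hn
  set e := tolConst d ℓ M c * ε / n with he
  set C := sampleConst d ℓ M c
  have hC0 : 0 < C := sampleConst_pos d ℓ M c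
  have hC : 2 * (M * M) ^ 2 * (1 + ℓ * ℓ * (2 + d) : ℕ) ≤ C * tolConst d ℓ M c ^ 2 :=
    (div_le_iff₀ (by positivity)).1 (le_max_right _ _)
  rw [le_div_iff₀ (by positivity)]
  calc (1 + ℓ * ℓ * (2 + d) : ℕ) * Real.log (2 * n / δ) * (2 * (M * M) ^ 2)
      = 2 * (M * M) ^ 2 * (1 + ℓ * ℓ * (2 + d) : ℕ) * Real.log (2 * n / δ) := by ring
    _ ≤ C * tolConst d ℓ M c ^ 2 * Real.log (2 * n / δ) := mul_le_mul_of_nonneg_right hC hlog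
    _ = e ^ 2 * (C * ((n : ℝ) ^ 2 / ε ^ 2) * Real.log (2 * n / δ)) := by
        rw [he]
        field_simp
    _ ≤ e ^ 2 * (C * (((n : ℝ) ^ 2 + ε * n) / ε ^ 2) * Real.log (2 * n / δ)) := by
        gcongr
        exact le_add_of_nonneg_right (by positivity)
    _ ≤ e ^ 2 * B := mul_le_mul_of_nonneg_left hB (sq_nonneg e)

theorem measureReal_isClose_ge {n d ℓ : ℕ} {sk : Sketch n d} {p : PMF (Config n d)}
    {M c ε δ : ℝ} (h : sk.IsAdapted (massFn p) ℓ M c) (hn : 1 ≤ n) (hε : 0 < ε) (hδ : 0 < δ)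
    (hδ1 : δ ≤ 1) {B : ℕ}
    (hB : sampleConst d ℓ M c * (((n : ℝ) ^ 2 + ε * n) / ε ^ 2) * Real.log (2 * n / δ) ≤ B) :
    1 - δ ≤ (sampleLaw p B).real
      {ω | sk.IsClose (massFn p) (empirical ω) (tolConst d ℓ M c * ε / n)} := by
  have hn1 : (1 : ℝ) ≤ n := by exact_mod_cast hn
  have : (0 : ℝ) < n := one_pos.trans_le hn1
  have htol := h.tolConst_pos
  have hC := sampleConst_pos d ℓ M c
  have hlog : 0 < Real.log (2 * n / δ) := Real.log_pos (by
    rw [lt_div_iff₀ hδ]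
    linarith)
  have hB0 : 0 < B := Nat.cast_pos.1 (lt_of_lt_of_le (by positivity) hB)
  set e := tolConst d ℓ M c * ε / n
  have hfar : (sampleLaw p B).real {ω | ¬ sk.IsClose (massFn p) (empirical ω) e} ≤ δ := by
    have hexp := neg_le_neg (h.mul_log_le_of_sampleConst_le hn hε hlog.le hB)
    have hcount : ((n : ℝ) + 1) * (ℓ * ℓ) + n * (ℓ * d * ℓ) ≤ n * (ℓ * ℓ * (2 + d) : ℕ) := by
      push_cast
      linear_combination (ℓ * ℓ : ℝ) * hn1
    calc (sampleLaw p B).real {ω | ¬ sk.IsClose (massFn p) (empirical ω) e}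
        ≤ ((n + 1) * (ℓ * ℓ) + n * (ℓ * d * ℓ)) *
            (2 * Real.exp (-(e ^ 2 * B / (2 * (M * M) ^ 2)))) :=
          h.bounded.measureReal_not_isClose_le p hB0 (by positivity)
      _ ≤ (n * (ℓ * ℓ * (2 + d) : ℕ)) *
            (2 * Real.exp (-((1 + ℓ * ℓ * (2 + d) : ℕ) * Real.log (2 * n / δ)))) := by
          gcongr
      _ ≤ δ := mul_exp_neg_mul_log_le _ hn hδ hδ1
  have hcompl := probReal_compl_eq_one_sub (μ := sampleLaw p B)
    (s := {ω | sk.IsClose (massFn p) (empirical ω) e}) (Set.toFinite _).measurableSet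
  rw [Set.compl_ofPred] at hcompl
  linarith

end Sketch.IsAdapted

end

theorem proposition2_general :
    (∀ (n d : ℕ) (p : PMF (Config n d)), ∃ (sk : Sketch n d) (c : ℝ), 0 < c ∧
      (∀ k, sk.m k = unfoldingRank (massFn p) k ∧ sk.l k = unfoldingRank (massFn p) k) ∧
      (∀ k x β, |sk.S k x β| ≤ 1) ∧ (∀ k x γ, |sk.T k x γ| ≤ 1) ∧
      sk.PreservesRank (massFn p) c) ∧
    (∀ (d ℓ : ℕ) (M c : ℝ), 0 < c → ∃ C : ℝ, 0 < C ∧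
      ∀ (n : ℕ), 1 ≤ n → ∀ (p : PMF (Config n d)) (sk : Sketch n d),
      sk.BoundedBy ℓ M → sk.PreservesRank (massFn p) c →
      ∀ (ε δ : ℝ), 0 < ε → ε ≤ 1 → 0 < δ → δ ≤ 1 →
      ∀ (B : ℕ), C * (((n : ℝ) ^ 2 + ε * n) / ε ^ 2) * Real.log (2 * n / δ) ≤ B →
        (∀ ω : Fin B → Config n d, ∃ ψ : MPS n d,
          IsTTNSSketchOutput sk (empirical ω) (unfoldingRank (massFn p)) ψ) ∧
        1 - δ ≤ (sampleLaw p B).real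
          {ω | ∀ ψ : MPS n d,
            IsTTNSSketchOutput sk (empirical ω) (unfoldingRank (massFn p)) ψ →
              ψ.weight ≠ 0 ∧ ‖massFn p - ψ.directDensity‖ < ε ∧ ‖massFn p - ψ.eval‖ < ε}) := by
  refine ⟨fun n d p => exists_sketch_preservesRank (massFn_ne_zero p), fun d ℓ M c hc =>
    ⟨sampleConst d ℓ M c, sampleConst_pos d ℓ M c, ?_⟩⟩
  intro n hn p sk hbdd hpres ε δ hε hε1 hδ hδ1 B hB
  have hd : 0 < d := (p.support_nonempty.some ⟨0, hn⟩).pos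
  have h : sk.IsAdapted (massFn p) ℓ M c :=
    ⟨hd, massFn_nonneg p, sum_massFn p, hbdd, hc, hpres⟩
  refine ⟨fun ω => exists_isTTNSSketchOutput (unfoldingRank_zero h.ne_zero)
    (unfoldingRank_last h.ne_zero) h.unfoldingRank_le_card_right _,
    (h.measureReal_isClose_ge hn hε hδ hδ1 hB).trans (measureReal_mono fun ω hclose ψ hψ => ?_)⟩
  exact MPS.norm_sub_lt_of_sum_abs_sub_le h.nonneg h.sum_eq_one hε hε1
    (h.sum_abs_eval_sub_le_of_isClose hn hε hε1 hclose hψ)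

theorem proposition2 :
    -- every Born machine admits rank-preserving sketches of size at most the squared bond dimension
    (∀ (n d : ℕ), 1 ≤ n → ∀ (p : PMF (Config n d)) (θ : MPS n d), IsBornMachine p θ →
      (∀ k, unfoldingRank (massFn p) k ≤ θ.bond k ^ 2) ∧
      ∃ (sk : Sketch n d) (c : ℝ), 0 < c ∧
        (∀ k, sk.m k ≤ θ.bond k ^ 2 ∧ sk.l k ≤ θ.bond k ^ 2) ∧
        (∀ k x β, |sk.S k x β| ≤ 1) ∧ (∀ k x γ, |sk.T k x γ| ≤ 1) ∧
        sk.PreservesRank (massFn p) c) ∧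
    -- the sample complexity, with a constant that depends only on `d`, `ℓ`, `M` and `c`
    (∀ (d ℓ : ℕ) (M c : ℝ), 0 < c → ∃ C : ℝ, 0 < C ∧
      ∀ (n : ℕ), 1 ≤ n → ∀ (p : PMF (Config n d)) (θ : MPS n d), IsBornMachine p θ →
      ∀ (sk : Sketch n d), sk.BoundedBy ℓ M → sk.PreservesRank (massFn p) c →
      ∀ (ε δ : ℝ), 0 < ε → ε ≤ 1 → 0 < δ → δ < 1 →
      ∀ (B : ℕ), C * (((n : ℝ) ^ 2 + ε * n) / ε ^ 2) * Real.log (2 * n / δ) ≤ B →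
        (∀ ω : Fin B → Config n d, ∃ ψ : MPS n d,
          IsTTNSSketchOutput sk (empirical ω) (unfoldingRank (massFn p)) ψ) ∧
        1 - δ ≤ (sampleLaw p B).real
          {ω | ∀ ψ : MPS n d,
            IsTTNSSketchOutput sk (empirical ω) (unfoldingRank (massFn p)) ψ →
              (∀ k, ψ.bond k ≤ θ.bond k ^ 2) ∧ ψ.weight ≠ 0 ∧
              ‖massFn p - ψ.directDensity‖ < ε ∧ ‖massFn p - ψ.eval‖ < ε}) := by
  obtain ⟨hsketch, hsample⟩ := proposition2_general
  refine ⟨fun n d _ p θ hθ => ⟨hθ.unfoldingRank_le, ?_⟩, fun d ℓ M c hc => ?_⟩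
  · obtain ⟨sk, c, hc, hdim, hS, hT, hsk⟩ := hsketch n d p
    exact ⟨sk, c, hc, fun k => ⟨(hdim k).1.trans_le (hθ.unfoldingRank_le k),
      (hdim k).2.trans_le (hθ.unfoldingRank_le k)⟩, hS, hT, hsk⟩
  · obtain ⟨C, hC, hrun⟩ := hsample d ℓ M c hc
    refine ⟨C, hC, fun n hn p θ hθ sk hbdd hpres ε δ hε hε1 hδ hδ1 B hB => ?_⟩
    obtain ⟨hexists, hprob⟩ := hrun n hn p sk hbdd hpres ε δ hε hε1 hδ hδ1.le B hB
    exact ⟨hexists, hprob.trans (measureReal_mono fun ω hω ψ hψ =>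
      ⟨fun k => (hψ.1 k).trans_le (hθ.unfoldingRank_le k), hω ψ hψ⟩)⟩
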